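/- For $N\ge 2$ let $u=(u_{ij})$ be the fundamental representation of the free orthogonal quantum group $O_N^+$ on $H_1=\mathbb C^N$, let $u_0,u_1,u_2,\dots$ be its irreducible unitary representations, and let $H_n\subseteq H_1^{\otimes n}$ be the space of $u_n$, i.e. the unique copy of $u_n$ in $u^{\otimes n}$ (equivalently, the space of all vectors of $H_1^{\otimes n}$ that are killed by every intertwiner from $u^{\otimes n}$ to $u^{\otimes j}$ with $j<n$). Let $p_n$ be the orthogonal projection of $H_1^{\otimes n}$ onto $H_n$, let $[n+1]_q=\dim H_n$, and let $[n]_q!=[n]_q\cdots[1]_q$, with $[0]_q!=1$. Let $(l,m,k)$ be an admissible triple of non-negative integers, that is, $k\in\{|l-m|,|l-m|+2,\dots,l+m\}$, and put $r=\frac{l+m-k}{2}$. Let $T_{2r}:\mathbb C\to H_1^{\otimes r}\otimes H_1^{\otimes r}$ be given by $T_{2r}(1)=\sum_{i_1,\dots,i_r=1}^N|i_1i_2\cdots i_r\rangle\otimes|i_r\cdots i_2i_1\rangle$, let $$\theta_q(k,l,m)=\frac{[r]_q!\,[l-r]_q!\,[m-r]_q!\,[k+r+1]_q!}{[l]_q!\,[m]_q!\,[k]_q!},$$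 $$\alpha^{l,m}_k=\sqrt{\frac{[k+1]_q}{\theta_q(k,l,m)}}\,(p_l\otimes p_m)(\mathrm{id}_{H_1^{\otimes(l-r)}}\otimes T_{2r}\otimes \mathrm{id}_{H_1^{\otimes(m-r)}})\big|_{H_k}:H_k\to H_1^{\otimes l}\otimes H_1^{\otimes m},$$ and define the maps $\Phi^{k\to l}_m,\Psi^{k\to l}_m:B(H_k)\to B(H_1^{\otimes l})$ by $$\Phi^{k\to l}_m(\rho)=(\mathrm{id}\otimes\mathrm{Tr})\bigl(\alpha^{l,m}_k\,\rho\,(\alpha^{l,m}_k)^*\bigr),\qquad \Psi^{k\to l}_m(\rho)=(\mathrm{id}_{H_1^{\otimes(l-r)}}\otimes\mathrm{Tr}_{H_1^{\otimes(m-r)}})(\rho)\otimes\frac1{N^r}\mathrm{Id}_{H_1^{\otimes r}},$$ where in the second formula $\rho$ is regarded as an operator on $H_1^{\otimes k}=H_1^{\otimes(l-r)}\otimes H_1^{\otimes(m-r)}$ that vanishes on $H_k^\perp$. For quantum channels $\Phi,\Psi:B(H_A)\to B(H_B)$ between finite-dimensional Hilbert spaces, the Bures distance is $\beta(\Phi,\Psi)=\inf\|V_\Phi-V_\Psi\|$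 (operator norm), the infimum being over all pairs of isometries $V_\Phi,V_\Psi:H_A\to H_B\otimes H_E$ with a common finite-dimensional $H_E$ such that $\Phi(\rho)=(\mathrm{id}\otimes\mathrm{Tr}_E)(V_\Phi\rho V_\Phi^*)$ and $\Psi(\rho)=(\mathrm{id}\otimes\mathrm{Tr}_E)(V_\Psi\rho V_\Psi^*)$, and $\|\Phi-\Psi\|_\diamond=\sup_{n}\|\mathrm{id}_n\otimes(\Phi-\Psi)\|$, where the norm is that of a map $S^1(\mathbb C^n\otimes H_A)\to S^1(\mathbb C^n\otimes H_B)$ between trace classes. Then for every admissible triple $(l,m,k)$ and every quantum channel (completely positive trace-preserving map) $\Phi':B(H_{A'})\to B(H_{B'})$ between finite-dimensional Hilbert spaces, both fixed as $N\to\infty$, $$\beta(\Phi^{k\to l}_m\otimes\Phi',\Psi^{k\to l}_m\otimes\Phi')=O(N^{-1})\quad\text{and}\quad\|\Phi^{k\to l}_m\otimes\Phi'-\Psi^{k\to l}_m\otimes\Phi'\|_\diamond=O(N^{-1}).$$ -/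

import Mathlib

open scoped TensorProduct ENNReal
open Filter

noncomputable section

namespace TLChannel

/-! ## Operators, channels and distances on finite-dimensional Hilbert spaces -/

section Channels

variable {A B A' B' E : Type*}
  [NormedAddCommGroup A] [InnerProductSpace ℂ A] [FiniteDimensional ℂ A]
  [NormedAddCommGroup B] [InnerProductSpace ℂ B] [FiniteDimensional ℂ B]
  [NormedAddCommGroup A'] [InnerProductSpace ℂ A'] [FiniteDimensional ℂ A']
  [NormedAddCommGroup B'] [InnerProductSpace ℂ B'] [FiniteDimensional ℂ B']
  [NormedAddCommGroup E] [InnerProductSpace ℂ E] [FiniteDimensional ℂ E]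

/-- `B(H)`, the algebra of all linear operators on a finite-dimensional Hilbert space `H`. -/
abbrev Op (H : Type*) [NormedAddCommGroup H] [InnerProductSpace ℂ H] : Type _ := H →ₗ[ℂ] H

/-- The tensor product `Φ ⊗ Φ' : B(A ⊗ A') → B(B ⊗ B')` of two linear maps between operator
algebras, under the identification `B(H) ⊗ B(K) = B(H ⊗ K)`. -/
def tensorMap (Φ : Op A →ₗ[ℂ] Op B) (Φ' : Op A' →ₗ[ℂ] Op B') :
    Op (A ⊗[ℂ] A') →ₗ[ℂ] Op (B ⊗[ℂ] B') :=
  (homTensorHomEquiv ℂ B B' B B').toLinearMap ∘ₗ TensorProduct.map Φ Φ' ∘ₗ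
    (homTensorHomEquiv ℂ A A' A A').symm.toLinearMap

/-- The partial trace `id ⊗ Tr : B(B ⊗ E) → B(B)`. -/
def partialTrace (B E : Type*)
    [NormedAddCommGroup B] [InnerProductSpace ℂ B] [FiniteDimensional ℂ B]
    [NormedAddCommGroup E] [InnerProductSpace ℂ E] [FiniteDimensional ℂ E] :
    Op (B ⊗[ℂ] E) →ₗ[ℂ] Op B :=
  (TensorProduct.rid ℂ (Op B)).toLinearMap ∘ₗ
    TensorProduct.map LinearMap.id (LinearMap.trace ℂ E) ∘ₗ
    (homTensorHomEquiv ℂ B E B E).symm.toLinearMap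

/-- Conjugation `ρ ↦ V ρ V*`. -/
def conj (V : A →ₗ[ℂ] B) : Op A →ₗ[ℂ] Op B where
  toFun ρ := V ∘ₗ ρ ∘ₗ V.adjoint
  map_add' ρ σ := by simp [LinearMap.add_comp, LinearMap.comp_add]
  map_smul' c ρ := by simp [LinearMap.smul_comp, LinearMap.comp_smul]

/-- A quantum channel `B(A) → B(B)`: a completely positive trace-preserving linear map. -/
structure IsQuantumChannel (Φ : Op A →ₗ[ℂ] Op B) : Prop where
  completelyPositive : ∀ (n : ℕ) (X : Op (EuclideanSpace ℂ (Fin n) ⊗[ℂ] A)), X.IsPositive →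
    (tensorMap (LinearMap.id : Op (EuclideanSpace ℂ (Fin n)) →ₗ[ℂ] _) Φ X).IsPositive
  tracePreserving : ∀ ρ : Op A, LinearMap.trace ℂ B (Φ ρ) = LinearMap.trace ℂ A ρ

/-- `V : A → B ⊗ E` is a Stinespring isometry of `Φ`, i.e. `Φ(ρ) = (id ⊗ Tr_E)(V ρ V*)`. -/
def IsStinespring (Φ : Op A →ₗ[ℂ] Op B) (V : A →ₗᵢ[ℂ] B ⊗[ℂ] E) : Prop :=
  ∀ ρ : Op A, Φ ρ = partialTrace B E (conj V.toLinearMap ρ)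

/-- The Bures distance: the infimum of `‖V - W‖` (operator norm) over all pairs of Stinespring
isometries `V` of `Φ` and `W` of `Ψ` with a common environment `E`.
The value is `∞` if there is no such pair. -/
def buresDist (Φ Ψ : Op A →ₗ[ℂ] Op B) : ℝ≥0∞ :=
  ⨅ (d : ℕ) (V : A →ₗᵢ[ℂ] B ⊗[ℂ] EuclideanSpace ℂ (Fin d))
    (W : A →ₗᵢ[ℂ] B ⊗[ℂ] EuclideanSpace ℂ (Fin d))
    (_ : IsStinespring Φ V) (_ : IsStinespring Ψ W),
    ‖V.toContinuousLinearMap - W.toContinuousLinearMap‖ₑ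

/-- The trace norm (norm of `S¹(A)`): the sum of the singular values. -/
def traceNorm (X : Op A) : ℝ := X.singularValues.sum fun _ s => s

/-- The diamond norm `sup_n ‖id_n ⊗ Δ‖`, where `id_n ⊗ Δ` is regarded as a map
`S¹(ℂⁿ ⊗ A) → S¹(ℂⁿ ⊗ B)`. -/
def diamondNorm (Δ : Op A →ₗ[ℂ] Op B) : ℝ≥0∞ :=
  ⨆ (n : ℕ) (X : Op (EuclideanSpace ℂ (Fin n) ⊗[ℂ] A)) (_ : traceNorm X ≤ 1),
    ENNReal.ofReal
      (traceNorm (tensorMap (LinearMap.id : Op (EuclideanSpace ℂ (Fin n)) →ₗ[ℂ] _) Δ X))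

end Channels

/-! ## The free orthogonal quantum group and its irreducible representations -/

/-- The defining relations of the free orthogonal quantum group `O_N^+`: the matrix
`u = (u_{ij})` satisfies `u uᵗ = 1 = uᵗ u`. -/
inductive OPlusRel (N : ℕ) :
    FreeAlgebra ℂ (Fin N × Fin N) → FreeAlgebra ℂ (Fin N × Fin N) → Prop
  | mul_transpose (i j : Fin N) :
      OPlusRel N (∑ k, FreeAlgebra.ι ℂ (i, k) * FreeAlgebra.ι ℂ (j, k)) (if i = j then 1 else 0)
  | transpose_mul (i j : Fin N) :
      OPlusRel N (∑ k, FreeAlgebra.ι ℂ (k, i) * FreeAlgebra.ι ℂ (k, j)) (if i = j then 1 else 0)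

/-- The algebra of polynomial functions on `O_N^+`: the universal unital complex algebra generated
by the entries of an `N × N` matrix `u` with `u uᵗ = 1 = uᵗ u`. (Its involution is the one for
which the generators are self-adjoint, so that `u` is unitary; the notion of an intertwiner does
not involve it.) -/
abbrev OPlus (N : ℕ) : Type := RingQuot (OPlusRel N)

/-- The entry `u_{ij}` of the fundamental representation of `O_N^+`. -/
def gen (N : ℕ) (i j : Fin N) : OPlus N :=
  RingQuot.mkAlgHom ℂ (OPlusRel N) (FreeAlgebra.ι ℂ (i, j))

/-- `H_1^{⊗ n}` for `H_1 = ℂ^N`, with orthonormal basis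
`e_x = |x_0 x_1 ⋯ x_{n-1}⟩`, `x : Fin n → Fin N`. -/
abbrev TensorPow (N n : ℕ) : Type := EuclideanSpace ℂ (Fin n → Fin N)

/-- The basis vector `|x_0 x_1 ⋯ x_{n-1}⟩`. -/
def ket {N n : ℕ} (x : Fin n → Fin N) : TensorPow N n := EuclideanSpace.single x 1

/-- The matrix coefficient `u_{x_0 y_0} u_{x_1 y_1} ⋯ u_{x_{n-1} y_{n-1}}` of the tensor power
`u^{⊗ n}` of the fundamental representation, acting on `H_1^{⊗ n}`. -/
def powCoeff (N n : ℕ) (x y : Fin n → Fin N) : OPlus N :=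
  (List.ofFn fun s => gen N (x s) (y s)).prod

/-- `S : H_1^{⊗ n} → H_1^{⊗ j}` is an intertwiner from `u^{⊗ n}` to `u^{⊗ j}`:
`S u^{⊗ n} = u^{⊗ j} S`. -/
def IsIntertwiner (N : ℕ) {n j : ℕ} (S : TensorPow N n →ₗ[ℂ] TensorPow N j) : Prop :=
  ∀ (x : Fin j → Fin N) (z : Fin n → Fin N),
    ∑ y : Fin n → Fin N, S (ket y) x • powCoeff N n y z =
      ∑ w : Fin j → Fin N, S (ket z) w • powCoeff N j x w

/-- The space `H_n ⊆ H_1^{⊗ n}` of the `n`-th irreducible representation `u_n` of `O_N^+`.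
By the fusion rules, `u^{⊗ n}` contains `u_n` exactly once, and all its other irreducible
constituents are among the `u_j` with `j < n`; such a `u_j` is contained in `u^{⊗ j}`, while `u_n`
is not contained in any `u^{⊗ j}` with `j < n`. So `H_n` consists of the vectors that are killed by
all intertwiners from `u^{⊗ n}` to lower tensor powers of `u`. -/
def irrepSpace (N n : ℕ) : Submodule ℂ (TensorPow N n) where
  carrier := {ξ | ∀ j < n, ∀ S : TensorPow N n →ₗ[ℂ] TensorPow N j, IsIntertwiner N S → S ξ = 0}
  zero_mem' := fun _ _ _ _ => map_zero _
  add_mem' := fun hξ hη j hj S hS => by rw [map_add, hξ j hj S hS, hη j hj S hS, add_zero]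
  smul_mem' := fun c ξ hξ j hj S hS => by rw [map_smul, hξ j hj S hS, smul_zero]

/-- The orthogonal projection `p_n` of `H_1^{⊗ n}` onto `H_n`, as an operator on `H_1^{⊗ n}`. -/
def proj (N n : ℕ) : TensorPow N n →ₗ[ℂ] TensorPow N n :=
  (irrepSpace N n).starProjection.toLinearMap

/-- The quantum integer `[n + 1]_q = dim H_n`. -/
def qSucc (N n : ℕ) : ℝ := Module.finrank ℂ (irrepSpace N n)

/-- The quantum factorial `[n]_q! = [n]_q ⋯ [2]_q [1]_q`, with `[0]_q! = 1`. -/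
def qFactorial (N n : ℕ) : ℝ := ∏ i ∈ Finset.range n, qSucc N i

/-- The theta-net `θ_q(k, l, m)`, where `r = (l + m - k) / 2`. -/
def thetaNet (N k l m r : ℕ) : ℝ :=
  qFactorial N r * qFactorial N (l - r) * qFactorial N (m - r) * qFactorial N (k + r + 1) /
    (qFactorial N l * qFactorial N m * qFactorial N k)

/-! ## Temperley–Lieb channels -/

/-- The identification `H_1^{⊗ a} ⊗ H_1^{⊗ b} = H_1^{⊗ n}`, `a + b = n`, which sends
`|x⟩ ⊗ |y⟩` to `|xy⟩`. -/
def concat (N : ℕ) {a b n : ℕ} (h : a + b = n) :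
    TensorPow N a ⊗[ℂ] TensorPow N b ≃ₗᵢ[ℂ] TensorPow N n :=
  ((EuclideanSpace.basisFun (Fin a → Fin N) ℂ).tensorProduct
      (EuclideanSpace.basisFun (Fin b → Fin N) ℂ)).equiv
    (EuclideanSpace.basisFun (Fin n → Fin N) ℂ)
    ((Fin.appendEquiv a b).trans ((finCongr h).arrowCongr (Equiv.refl (Fin N))))

/-- The map `id_a ⊗ T_{2r} ⊗ id_b : H_1^{⊗ k} → H_1^{⊗ l} ⊗ H_1^{⊗ m}`, where `k = a + b`,
`l = a + r`, `m = r + b` and `T_{2r}(1) = ∑_i |i_1 i_2 ⋯ i_r⟩ ⊗ |i_r ⋯ i_2 i_1⟩`. The sum is over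
`i = (i_1, …, i_r)`, and the summand is `|x⟩ ⊗ |y⟩ ↦ |x i⟩ ⊗ |i' y⟩` with `i'` the reversal
of `i`. -/
def cupInsert (N : ℕ) {l m k : ℕ} (a r b : ℕ) (hl : a + r = l) (hm : r + b = m) (hk : a + b = k) :
    TensorPow N k →ₗ[ℂ] TensorPow N l ⊗[ℂ] TensorPow N m :=
  (∑ i : Fin r → Fin N,
    TensorProduct.map
      ((concat N hl).toLinearEquiv.toLinearMap ∘ₗ
        (TensorProduct.mk ℂ (TensorPow N a) (TensorPow N r)).flip (ket i))
      ((concat N hm).toLinearEquiv.toLinearMap ∘ₗ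
        TensorProduct.mk ℂ (TensorPow N r) (TensorPow N b) (ket (i ∘ Fin.rev)))) ∘ₗ
    (concat N hk).symm.toLinearEquiv.toLinearMap

/-- `(l, m, k)` is an admissible triple: `k` is one of `|l - m|, |l - m| + 2, …, l + m`. -/
def Admissible (l m k : ℕ) : Prop :=
  |(l : ℤ) - m| ≤ k ∧ (k : ℤ) ≤ l + m ∧ Even ((l : ℤ) + m - k)

/-- The number `r = (l + m - k) / 2`. -/
def cups (l m k : ℕ) : ℕ := (l + m - k) / 2

theorem Admissible.left {l m k : ℕ} (h : Admissible l m k) :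
    (l - cups l m k) + cups l m k = l := by
  obtain ⟨h1, h2, c, hc⟩ := h
  rw [abs_le] at h1
  simp only [cups]
  omega

theorem Admissible.right {l m k : ℕ} (h : Admissible l m k) :
    cups l m k + (m - cups l m k) = m := by
  obtain ⟨h1, h2, c, hc⟩ := h
  rw [abs_le] at h1
  simp only [cups]
  omega

theorem Admissible.total {l m k : ℕ} (h : Admissible l m k) :
    (l - cups l m k) + (m - cups l m k) = k := by
  obtain ⟨h1, h2, c, hc⟩ := h
  rw [abs_le] at h1
  simp only [cups]
  omega

/-- The isometry `α^{l,m}_k : H_k → H_l ⊗ H_m ⊆ H_1^{⊗ l} ⊗ H_1^{⊗ m}`,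
`α^{l,m}_k = ([k+1]_q / θ_q(k,l,m))^{1/2} (p_l ⊗ p_m)(id_{l-r} ⊗ T_{2r} ⊗ id_{m-r})`. -/
def alpha (N : ℕ) {l m k : ℕ} (h : Admissible l m k) :
    irrepSpace N k →ₗ[ℂ] TensorPow N l ⊗[ℂ] TensorPow N m :=
  ((√(qSucc N k / thetaNet N k l m (cups l m k)) : ℝ) : ℂ) •
    (TensorProduct.map (proj N l) (proj N m) ∘ₗ
      cupInsert N (l - cups l m k) (cups l m k) (m - cups l m k) h.left h.right h.total ∘ₗ
      (irrepSpace N k).subtype)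

/-- The `O_N^+`-Temperley–Lieb channel `Φ^{k→l}_m : B(H_k) → B(H_1^{⊗ l})`,
`ρ ↦ (id ⊗ Tr)(α ρ α*)`. -/
def Phi (N : ℕ) {l m k : ℕ} (h : Admissible l m k) :
    Op (irrepSpace N k) →ₗ[ℂ] Op (TensorPow N l) :=
  partialTrace (TensorPow N l) (TensorPow N m) ∘ₗ conj (alpha N h)

/-- The channel `Ψ^{k→l}_m : B(H_k) → B(H_1^{⊗ l})`,
`ρ ↦ (id ⊗ Tr_{H_1^{⊗ (m-r)}})(ρ) ⊗ N^{-r} Id_{H_1^{⊗ r}}`, where an operator on `H_k` is regarded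
as one on `H_1^{⊗ k} = H_1^{⊗ (l-r)} ⊗ H_1^{⊗ (m-r)}` and
`H_1^{⊗ (l-r)} ⊗ H_1^{⊗ r} = H_1^{⊗ l}`. -/
def Psi (N : ℕ) {l m k : ℕ} (h : Admissible l m k) :
    Op (irrepSpace N k) →ₗ[ℂ] Op (TensorPow N l) :=
  conj (concat N h.left).toLinearEquiv.toLinearMap ∘ₗ
    (homTensorHomEquiv ℂ _ _ _ _).toLinearMap ∘ₗ
    (TensorProduct.mk ℂ (Op (TensorPow N (l - cups l m k))) (Op (TensorPow N (cups l m k)))).flip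
      (((N : ℂ) ^ cups l m k)⁻¹ • LinearMap.id) ∘ₗ
    partialTrace (TensorPow N (l - cups l m k)) (TensorPow N (m - cups l m k)) ∘ₗ
    conj ((concat N h.total).symm.toLinearEquiv.toLinearMap ∘ₗ (irrepSpace N k).subtype)

end TLChannel

end

/-! Write `r = (l + m - k) / 2`, let `T` be the insertion of `r` nested cups restricted to `H_k`,
and let `P = p_l ⊗ p_m`. Both channels have Stinespring maps with environment `H_1^{⊗ m}`: `Φ` is
dilated by a multiple of `P T`, and `Ψ` by `N^{-r/2} T`, since tracing out the `r` contracted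
letters leaves the identity on the other `r` letters. Clearly `T* T = N^r`, and the heart of the
matter is that `T* P T` is a scalar `p`. As `P` is a projection, `(P T)* T = p` too, so the
normalized isometries `V`, `W` satisfy `V* W = s` with `s = √(p / N^r)`, whence `‖(V - W) x‖ = √(2
(1 - s)) ‖x‖`. This number bounds the Bures distance, and twice it bounds the diamond norm.
Tensoring both isometries with one dilation of `Φ'`, or of `id_n`, does not change `s`
(`dist_tensorMap_le`).

The scalar is computed by removing the innermost cup. Each removal contributes a factor `cupRatio`,
with a recursion that follows from the Jones–Wenzl recursion `annih_proj_create_succ` applied on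
both sides of the cup. Every factor is at least `N - 4/N`, so `p / N^r ≥ 1 - 4r/N²` by Bernoulli,
and the square root turns the defect of order `N^{-2}` into a distance of order `N^{-1}`. The
product telescopes to `θ / [k+1]` (`prod_cupRatio`), which is the normalization of `alpha`.

The Jones–Wenzl recursion requires that a vector killed by all caps lies in `H_n`, whereas `H_n` is
defined by all intertwiners of `O_N^+`. This is `capKernel_le_irrepSpace`: the projections onto
`cupSpan` commute with cups and caps, so their matrix entries define a functional on the algebra of
`O_N^+`; applied to the intertwiner relation, it shows that every intertwiner commutes with these
projections. No classification of the intertwiners is needed. -/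

noncomputable section

namespace TLChannel

/-! ### Stinespring dilations, their overlaps and their tensor products. -/

section Channels

set_option linter.unusedSectionVars false

variable {A B A' B' E E' B₁ E₁ : Type*}
  [NormedAddCommGroup A] [InnerProductSpace ℂ A] [FiniteDimensional ℂ A]
  [NormedAddCommGroup B] [InnerProductSpace ℂ B] [FiniteDimensional ℂ B]
  [NormedAddCommGroup A'] [InnerProductSpace ℂ A'] [FiniteDimensional ℂ A']
  [NormedAddCommGroup B'] [InnerProductSpace ℂ B'] [FiniteDimensional ℂ B']
  [NormedAddCommGroup E] [InnerProductSpace ℂ E] [FiniteDimensional ℂ E]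
  [NormedAddCommGroup E'] [InnerProductSpace ℂ E'] [FiniteDimensional ℂ E']
  [NormedAddCommGroup B₁] [InnerProductSpace ℂ B₁] [FiniteDimensional ℂ B₁]
  [NormedAddCommGroup E₁] [InnerProductSpace ℂ E₁] [FiniteDimensional ℂ E₁]

theorem homTensorHomEquiv_symm_map {P Q : Type*} [AddCommGroup P] [Module ℂ P]
    [AddCommGroup Q] [Module ℂ Q] [FiniteDimensional ℂ P] [FiniteDimensional ℂ Q]
    (Y : A →ₗ[ℂ] P) (Z : B →ₗ[ℂ] Q) :
    (homTensorHomEquiv ℂ A B P Q).symm (TensorProduct.map Y Z) = Y ⊗ₜ Z := by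
  rw [LinearEquiv.symm_apply_eq, homTensorHomEquiv_apply, TensorProduct.homTensorHomMap_apply]

theorem tensorMap_map (Φ : Op A →ₗ[ℂ] Op B) (Φ' : Op A' →ₗ[ℂ] Op B') (Y : Op A) (Z : Op A') :
    tensorMap Φ Φ' (TensorProduct.map Y Z) = TensorProduct.map (Φ Y) (Φ' Z) := by
  simp [tensorMap, homTensorHomEquiv_symm_map]

theorem partialTrace_map (Y : Op B) (Z : Op E) :
    partialTrace B E (TensorProduct.map Y Z) = LinearMap.trace ℂ E Z • Y := by
  simp [partialTrace, homTensorHomEquiv_symm_map]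

@[simp] theorem conj_apply (V : A →ₗ[ℂ] B) (ρ : Op A) : conj V ρ = V ∘ₗ ρ ∘ₗ V.adjoint := rfl

/-- Linear maps out of the operators on a tensor product are determined by their values on
tensor products of operators. -/
theorem linearMap_ext_map {M : Type*} [AddCommGroup M] [Module ℂ M]
    {f g : Op (A ⊗[ℂ] A') →ₗ[ℂ] M}
    (h : ∀ (Y : Op A) (Z : Op A'), f (TensorProduct.map Y Z) = g (TensorProduct.map Y Z)) :
    f = g := by
  have h2 : f ∘ₗ (homTensorHomEquiv ℂ A A' A A').toLinearMap =
      g ∘ₗ (homTensorHomEquiv ℂ A A' A A').toLinearMap := by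
    refine TensorProduct.ext' fun Y Z => ?_
    simp [h]
  refine LinearMap.ext fun X => ?_
  have := LinearMap.congr_fun h2 ((homTensorHomEquiv ℂ A A' A A').symm X)
  simpa only [LinearMap.comp_apply, LinearEquiv.coe_coe, LinearEquiv.apply_symm_apply] using this

/-- The rank-one operator `|x⟩⟨y|`. -/
def ketBra (x : A) (y : B) : B →ₗ[ℂ] A := (InnerProductSpace.rankOne ℂ x y).toLinearMap

@[simp] theorem ketBra_apply (x : A) (y z : B) : ketBra x y z = inner ℂ y z • x := rfl

theorem comp_ketBra_comp_adjoint (V : A →ₗ[ℂ] B) (x y : A) :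
    V ∘ₗ ketBra x y ∘ₗ V.adjoint = ketBra (V x) (V y) := by
  ext z
  simp [LinearMap.adjoint_inner_right]

theorem ketBra_tmul (x y : A) (x' y' : B) :
    ketBra (x ⊗ₜ[ℂ] x') (y ⊗ₜ[ℂ] y') = TensorProduct.map (ketBra x y) (ketBra x' y') := by
  refine TensorProduct.ext' fun z z' => ?_
  simp [TensorProduct.smul_tmul', TensorProduct.tmul_smul, smul_smul, mul_comm]

theorem trace_ketBra (x y : A) : LinearMap.trace ℂ A (ketBra x y) = inner ℂ y x :=
  InnerProductSpace.trace_rankOne x y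

theorem sum_ketBra {ι : Type*} [Fintype ι] (b : OrthonormalBasis ι ℂ A) (ρ : A →ₗ[ℂ] B) :
    ρ = ∑ i, ketBra (ρ (b i)) (b i) := by
  ext z
  conv_lhs => rw [← b.sum_repr' z]
  simp

theorem linearMap_ext_ketBra {M : Type*} [AddCommGroup M] [Module ℂ M] {f g : Op A →ₗ[ℂ] M}
    (h : ∀ x y : A, f (ketBra x y) = g (ketBra x y)) : f = g := by
  refine LinearMap.ext fun ρ => ?_
  rw [sum_ketBra (stdOrthonormalBasis ℂ A) ρ, map_sum, map_sum]
  simp [h]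

theorem trace_partialTrace (X : Op (B ⊗[ℂ] E)) :
    LinearMap.trace ℂ B (partialTrace B E X) = LinearMap.trace ℂ _ X := by
  have : LinearMap.trace ℂ B ∘ₗ partialTrace B E = LinearMap.trace ℂ _ := by
    refine linearMap_ext_map fun Y Z => ?_
    simp [partialTrace_map, LinearMap.trace_tensorProduct', mul_comm]
  exact LinearMap.congr_fun this X

/-- The partial trace is dual to `U ↦ U ⊗ 1` under the trace pairing; checking this on product
operators suffices. -/
theorem trace_comp_partialTrace (U : Op B) (X : Op (B ⊗[ℂ] E)) :
    LinearMap.trace ℂ B (U ∘ₗ partialTrace B E X) =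
      LinearMap.trace ℂ _ (TensorProduct.map U LinearMap.id ∘ₗ X) := by
  have : LinearMap.trace ℂ B ∘ₗ LinearMap.llcomp ℂ B B B U ∘ₗ partialTrace B E =
      LinearMap.trace ℂ _ ∘ₗ LinearMap.llcomp ℂ _ _ _ (TensorProduct.map U LinearMap.id) := by
    refine linearMap_ext_map fun Y Z => ?_
    simp only [LinearMap.comp_apply, partialTrace_map, LinearMap.llcomp_apply', map_smul]
    rw [← TensorProduct.map_comp]
    simp [LinearMap.trace_tensorProduct', mul_comm]
  exact LinearMap.congr_fun this X

@[simp] theorem ketBra_add_left (x x' : A) (y : B) :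
    ketBra (x + x') y = ketBra x y + ketBra x' y := by ext z; simp

@[simp] theorem ketBra_add_right (x : A) (y y' : B) :
    ketBra x (y + y') = ketBra x y + ketBra x y' := by ext z; simp [add_smul]

@[simp] theorem ketBra_zero_left (y : B) : ketBra (0 : A) y = 0 := by ext z; simp

@[simp] theorem ketBra_zero_right (x : A) : ketBra x (0 : B) = 0 := by ext z; simp

@[simp] theorem ketBra_sum_left {ι : Type*} (s : Finset ι) (x : ι → A) (y : B) :
    ketBra (∑ i ∈ s, x i) y = ∑ i ∈ s, ketBra (x i) y := by ext z; simp [Finset.smul_sum]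

@[simp] theorem ketBra_sum_right {ι : Type*} (s : Finset ι) (x : A) (y : ι → B) :
    ketBra x (∑ i ∈ s, y i) = ∑ i ∈ s, ketBra x (y i) := by
  ext z; simp [Finset.sum_smul]

/-- `V : A → B ⊗ E` satisfies `Φ(|x⟩⟨y|) = (id ⊗ Tr_E)(|V x⟩⟨V y|)`. -/
def Dilates (V : A →ₗ[ℂ] B ⊗[ℂ] E) (Φ : Op A →ₗ[ℂ] Op B) : Prop :=
  ∀ x y : A, Φ (ketBra x y) = partialTrace B E (ketBra (V x) (V y))

/-- Rank-one operators span all operators, so testing a dilation on them loses nothing and keeps the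
adjoint of `V` out of the computations. -/
theorem Dilates.apply {V : A →ₗ[ℂ] B ⊗[ℂ] E} {Φ : Op A →ₗ[ℂ] Op B} (h : Dilates V Φ)
    (ρ : Op A) : Φ ρ = partialTrace B E (conj V ρ) := by
  have : Φ = partialTrace B E ∘ₗ conj V := linearMap_ext_ketBra fun x y => by
    rw [h, LinearMap.comp_apply, conj_apply, comp_ketBra_comp_adjoint]
  exact LinearMap.congr_fun this ρ

theorem dilates_of_apply {V : A →ₗ[ℂ] B ⊗[ℂ] E} {Φ : Op A →ₗ[ℂ] Op B}
    (h : ∀ ρ, Φ ρ = partialTrace B E (conj V ρ)) : Dilates V Φ := fun x y => by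
  rw [h, conj_apply, comp_ketBra_comp_adjoint]

/-- The identity channel has the trivial environment `ℂ`; this serves for the amplifications in the
diamond norm. -/
theorem dilates_id : Dilates (TensorProduct.rid ℂ A).symm.toLinearMap
    (LinearMap.id : Op A →ₗ[ℂ] Op A) := by
  intro x y
  simp [ketBra_tmul, partialTrace_map, trace_ketBra]

/-- The isometric bilinear map which sends `b ⊗ e` and `b' ⊗ e'` to `(b ⊗ b') ⊗ (e ⊗ e')`, where
`B ⊗ B'` and `E ⊗ E'` are identified with `B₁` and `E₁`. -/
def regroup (eB : B ⊗[ℂ] B' ≃ₗᵢ[ℂ] B₁) (eE : E ⊗[ℂ] E' ≃ₗᵢ[ℂ] E₁) :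
    B ⊗[ℂ] E →ₗ[ℂ] B' ⊗[ℂ] E' →ₗ[ℂ] B₁ ⊗[ℂ] E₁ :=
  (TensorProduct.mk ℂ (B ⊗[ℂ] E) (B' ⊗[ℂ] E')).compr₂
    ((TensorProduct.congr eB.toLinearEquiv eE.toLinearEquiv).toLinearMap ∘ₗ
      (TensorProduct.tensorTensorTensorComm ℂ B E B' E').toLinearMap)

@[simp] theorem regroup_tmul (eB : B ⊗[ℂ] B' ≃ₗᵢ[ℂ] B₁) (eE : E ⊗[ℂ] E' ≃ₗᵢ[ℂ] E₁)
    (b : B) (e : E) (b' : B') (e' : E') :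
    regroup eB eE (b ⊗ₜ e) (b' ⊗ₜ e') = eB (b ⊗ₜ b') ⊗ₜ eE (e ⊗ₜ e') := by
  simp [regroup]

theorem inner_regroup (eB : B ⊗[ℂ] B' ≃ₗᵢ[ℂ] B₁) (eE : E ⊗[ℂ] E' ≃ₗᵢ[ℂ] E₁)
    (u v : B ⊗[ℂ] E) (u' v' : B' ⊗[ℂ] E') :
    inner ℂ (regroup eB eE u u') (regroup eB eE v v') = inner ℂ u v * inner ℂ u' v' := by
  induction u using TensorProduct.induction_on with
  | zero => simp
  | add x y hx hy => simp only [map_add, LinearMap.add_apply, inner_add_left, hx, hy, add_mul]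
  | tmul b e =>
  induction v using TensorProduct.induction_on with
  | zero => simp
  | add x y hx hy => simp only [map_add, LinearMap.add_apply, inner_add_right, hx, hy, add_mul]
  | tmul b₂ e₂ =>
  induction u' using TensorProduct.induction_on with
  | zero => simp
  | add x y hx hy => simp only [map_add, inner_add_left, hx, hy, mul_add]
  | tmul b' e' =>
  induction v' using TensorProduct.induction_on with
  | zero => simp
  | add x y hx hy => simp only [map_add, inner_add_right, hx, hy, mul_add]
  | tmul b₂' e₂' =>
    simp only [regroup_tmul, TensorProduct.inner_tmul, LinearIsometryEquiv.inner_map_map]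
    ring

/-- Both sides are additive in each of the four vectors, so elementary tensors suffice; there the
two environment traces multiply. -/
theorem partialTrace_ketBra_regroup (eB : B ⊗[ℂ] B' ≃ₗᵢ[ℂ] B₁) (eE : E ⊗[ℂ] E' ≃ₗᵢ[ℂ] E₁)
    (u v : B ⊗[ℂ] E) (u' v' : B' ⊗[ℂ] E') :
    partialTrace B₁ E₁ (ketBra (regroup eB eE u u') (regroup eB eE v v')) =
      eB.toLinearEquiv.conj
        (TensorProduct.map (partialTrace B E (ketBra u v)) (partialTrace B' E' (ketBra u' v'))) := by
  induction u using TensorProduct.induction_on with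
  | zero => simp
  | add x y hx hy => simp only [map_add, LinearMap.add_apply, ketBra_add_left, hx, hy,
      TensorProduct.map_add_left]
  | tmul b e =>
  induction v using TensorProduct.induction_on with
  | zero => simp
  | add x y hx hy => simp only [map_add, LinearMap.add_apply, ketBra_add_right, hx, hy,
      TensorProduct.map_add_left]
  | tmul b₂ e₂ =>
  induction u' using TensorProduct.induction_on with
  | zero => simp
  | add x y hx hy => simp only [map_add, ketBra_add_left, hx, hy, TensorProduct.map_add_right]
  | tmul b' e' =>
  induction v' using TensorProduct.induction_on with
  | zero => simp
  | add x y hx hy => simp only [map_add, ketBra_add_right, hx, hy, TensorProduct.map_add_right]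
  | tmul b₂' e₂' =>
    have h : ketBra (eB (b ⊗ₜ b')) (eB (b₂ ⊗ₜ b₂')) =
        eB.toLinearEquiv.conj (TensorProduct.map (ketBra b b₂) (ketBra b' b₂')) := by
      rw [← ketBra_tmul]
      ext z
      obtain ⟨w, rfl⟩ := eB.surjective z
      simp [LinearEquiv.conj_apply]
    simp only [regroup_tmul, ketBra_tmul, partialTrace_map, trace_ketBra, h,
      LinearIsometryEquiv.inner_map_map, TensorProduct.inner_tmul, TensorProduct.map_smul_left,
      TensorProduct.map_smul_right, smul_smul, map_smul]
    rw [mul_comm]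

/-- The tensor product of two dilations. -/
def tensorDilation (eB : B ⊗[ℂ] B' ≃ₗᵢ[ℂ] B₁) (eE : E ⊗[ℂ] E' ≃ₗᵢ[ℂ] E₁)
    (V : A →ₗ[ℂ] B ⊗[ℂ] E) (V' : A' →ₗ[ℂ] B' ⊗[ℂ] E') : A ⊗[ℂ] A' →ₗ[ℂ] B₁ ⊗[ℂ] E₁ :=
  TensorProduct.lift ((regroup eB eE).compl₁₂ V V')

@[simp] theorem tensorDilation_tmul (eB : B ⊗[ℂ] B' ≃ₗᵢ[ℂ] B₁) (eE : E ⊗[ℂ] E' ≃ₗᵢ[ℂ] E₁)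
    (V : A →ₗ[ℂ] B ⊗[ℂ] E) (V' : A' →ₗ[ℂ] B' ⊗[ℂ] E') (x : A) (x' : A') :
    tensorDilation eB eE V V' (x ⊗ₜ x') = regroup eB eE (V x) (V' x') := rfl

theorem Dilates.tensor {V : A →ₗ[ℂ] B ⊗[ℂ] E} {V' : A' →ₗ[ℂ] B' ⊗[ℂ] E'}
    {Φ : Op A →ₗ[ℂ] Op B} {Φ' : Op A' →ₗ[ℂ] Op B'} (h : Dilates V Φ) (h' : Dilates V' Φ')
    (eE : E ⊗[ℂ] E' ≃ₗᵢ[ℂ] E₁) :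
    Dilates (tensorDilation (.refl ℂ (B ⊗[ℂ] B')) eE V V') (tensorMap Φ Φ') := by
  intro x y
  induction x using TensorProduct.induction_on with
  | zero => simp
  | add x₁ x₂ h₁ h₂ => simp only [map_add, ketBra_add_left, h₁, h₂]
  | tmul x x' =>
  induction y using TensorProduct.induction_on with
  | zero => simp
  | add x₁ x₂ h₁ h₂ => simp only [map_add, ketBra_add_right, h₁, h₂]
  | tmul y y' =>
    rw [ketBra_tmul, tensorMap_map, h, h', tensorDilation_tmul, tensorDilation_tmul,
      partialTrace_ketBra_regroup]
    rfl

/-- `V` and `W` satisfy `V* W = c`. -/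
def InnerScale (V W : A →ₗ[ℂ] B) (c : ℂ) : Prop := ∀ x y : A, inner ℂ (V x) (W y) = c * inner ℂ x y

/-- Overlaps multiply. With `d = 1` this says that tensoring with a fixed isometry preserves the
overlap. -/
theorem InnerScale.tensor {V W : A →ₗ[ℂ] B ⊗[ℂ] E} {V' W' : A' →ₗ[ℂ] B' ⊗[ℂ] E'} {c d : ℂ}
    (h : InnerScale V W c) (h' : InnerScale V' W' d)
    (eB : B ⊗[ℂ] B' ≃ₗᵢ[ℂ] B₁) (eE : E ⊗[ℂ] E' ≃ₗᵢ[ℂ] E₁) :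
    InnerScale (tensorDilation eB eE V V') (tensorDilation eB eE W W') (c * d) := by
  intro x y
  induction x using TensorProduct.induction_on with
  | zero => simp
  | add x₁ x₂ h₁ h₂ => simp only [map_add, inner_add_left, h₁, h₂, mul_add]
  | tmul x x' =>
  induction y using TensorProduct.induction_on with
  | zero => simp
  | add x₁ x₂ h₁ h₂ => simp only [map_add, inner_add_right, h₁, h₂, mul_add]
  | tmul y y' =>
    rw [tensorDilation_tmul, tensorDilation_tmul, inner_regroup, h x y, h' x' y',
      TensorProduct.inner_tmul]
    ring

end Channels

/-! ### Bures and diamond distances bounded by the overlap of two isometries. -/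

section Distances

set_option linter.unusedSectionVars false

variable {A B A' B' E E' B₁ E₁ : Type*}
  [NormedAddCommGroup A] [InnerProductSpace ℂ A] [FiniteDimensional ℂ A]
  [NormedAddCommGroup B] [InnerProductSpace ℂ B] [FiniteDimensional ℂ B]
  [NormedAddCommGroup A'] [InnerProductSpace ℂ A'] [FiniteDimensional ℂ A']
  [NormedAddCommGroup B'] [InnerProductSpace ℂ B'] [FiniteDimensional ℂ B']
  [NormedAddCommGroup E] [InnerProductSpace ℂ E] [FiniteDimensional ℂ E]
  [NormedAddCommGroup E'] [InnerProductSpace ℂ E'] [FiniteDimensional ℂ E']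
  [NormedAddCommGroup B₁] [InnerProductSpace ℂ B₁] [FiniteDimensional ℂ B₁]
  [NormedAddCommGroup E₁] [InnerProductSpace ℂ E₁] [FiniteDimensional ℂ E₁]

theorem inner_self_complex (x : A) : inner ℂ x x = ((‖x‖ ^ 2 : ℝ) : ℂ) := by
  rw [inner_self_eq_norm_sq_to_K, Complex.ofReal_pow]
  rfl

theorem traceNorm_eq_sum (X : Op A) :
    traceNorm X = ∑ i : Fin (Module.finrank ℂ A), X.singularValues i := by
  rw [traceNorm, Finset.sum_fin_eq_sum_range, Finsupp.sum]
  rw [Finset.sum_subset (s₂ := Finset.range (Module.finrank ℂ A))]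
  · refine Finset.sum_congr rfl fun i hi => ?_
    rw [dif_pos (Finset.mem_range.1 hi)]
  · intro i hi
    by_contra h
    rw [Finset.mem_range, not_lt] at h
    exact (Finsupp.mem_support_iff.1 hi) (X.singularValues_of_finrank_le h)
  · intro i _ hi
    exact Finsupp.notMem_support_iff.1 hi

theorem traceNorm_nonneg (X : Op A) : 0 ≤ traceNorm X := by
  rw [traceNorm_eq_sum]
  exact Finset.sum_nonneg fun i _ => X.singularValues_nonneg i

/-- A singular value decomposition: `X` maps an orthonormal basis to an orthogonal family. -/
theorem exists_singular_basis (X : Op A) :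
    ∃ e : OrthonormalBasis (Fin (Module.finrank ℂ A)) ℂ A,
      ∀ i j, inner ℂ (X (e i)) (X (e j)) = if i = j then ((X.singularValues i : ℝ) : ℂ) ^ 2 else 0 := by
  let e := X.isSymmetric_adjoint_comp_self.eigenvectorBasis (n := Module.finrank ℂ A) rfl
  refine ⟨e, fun i j => ?_⟩
  rw [← LinearMap.adjoint_inner_right, ← LinearMap.comp_apply,
    LinearMap.IsSymmetric.apply_eigenvectorBasis, inner_smul_right,
    ← X.sq_singularValues_fin rfl, e.inner_eq_ite]
  by_cases h : i = j
  · subst h; simp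
  · simp [h]

/-- One half of the duality between trace norm and operator norm: the trace is evaluated in a right
singular basis `e` of `X`, where `‖X (e i)‖` is the `i`-th singular value. -/
theorem norm_trace_comp_le (T X : Op A) (K : ℝ)
    (hT : ∀ x y : A, ‖inner ℂ y (T x)‖ ≤ K * ‖x‖ * ‖y‖) :
    ‖LinearMap.trace ℂ A (T ∘ₗ X)‖ ≤ K * traceNorm X := by
  obtain ⟨e, he⟩ := exists_singular_basis X
  have hn (i) : ‖X (e i)‖ = X.singularValues i := by
    have := he i i
    rw [inner_self_complex, if_pos rfl, ← Complex.ofReal_pow] at this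
    exact (sq_eq_sq₀ (norm_nonneg _) (X.singularValues_nonneg i)).1 (Complex.ofReal_injective this)
  rw [LinearMap.trace_eq_sum_inner _ e, traceNorm_eq_sum, Finset.mul_sum]
  refine (norm_sum_le _ _).trans (Finset.sum_le_sum fun i _ => ?_)
  refine (hT _ _).trans ?_
  simp [hn]

/-- The other half of the duality: `U` is the adjoint of the partial isometry in the polar
decomposition of `X`. -/
theorem exists_contraction_trace (X : Op A) :
    ∃ U : Op A, (∀ x, ‖U x‖ ≤ ‖x‖) ∧ LinearMap.trace ℂ A (U ∘ₗ X) = traceNorm X := by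
  obtain ⟨e, he⟩ := exists_singular_basis X
  set σ : Fin (Module.finrank ℂ A) → ℝ := fun i => X.singularValues i with hσ
  let ι := {i // σ i ≠ 0}
  -- The left singular vectors. Only nonzero singular values are kept, since the others cannot be
  -- normalized.
  let f : ι → A := fun i => ((σ i : ℂ))⁻¹ • X (e i)
  have hf : Orthonormal ℂ f := by
    rw [orthonormal_iff_ite]
    intro i j
    simp only [f, inner_smul_left, inner_smul_right, he]
    by_cases h : i = j
    · subst h
      have : (σ i : ℂ) ≠ 0 := by exact_mod_cast i.2
      simp only [if_true]
      change (σ i : ℂ)⁻¹ * ((starRingEnd ℂ) (σ i : ℂ)⁻¹ * (σ i : ℂ) ^ 2) = 1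
      simp only [map_inv₀, Complex.conj_ofReal]
      field_simp
    · have h' : i.1 ≠ j.1 := fun h2 => h (Subtype.ext h2)
      simp [h, h']
  let U : Op A := ∑ i : ι, ketBra (e i) (f i)
  refine ⟨U, fun x => ?_, ?_⟩
  · have h1 : U x = ∑ i : ι, inner ℂ (f i) x • e i := by simp [U]
    have he' : Orthonormal ℂ fun i : ι => e i := e.orthonormal.comp _ Subtype.val_injective
    have h2 : ‖U x‖ ^ 2 = ∑ i : ι, ‖inner ℂ (f i) x‖ ^ 2 := by
      have h3 := he'.inner_sum (fun i => inner ℂ (f i) x) (fun i => inner ℂ (f i) x) Finset.univ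
      rw [← h1, inner_self_complex] at h3
      have h4 : ∀ i : ι, (starRingEnd ℂ) (inner ℂ (f i) x) * inner ℂ (f i) x =
          ((‖inner ℂ (f i) x‖ ^ 2 : ℝ) : ℂ) := fun i => by
        rw [Complex.conj_mul', Complex.ofReal_pow]
      simp only [h4] at h3
      rw [← Complex.ofReal_sum] at h3
      exact Complex.ofReal_injective h3
    have h3 : ‖U x‖ ^ 2 ≤ ‖x‖ ^ 2 := h2.trans_le (hf.sum_inner_products_le x)
    exact (sq_le_sq₀ (norm_nonneg _) (norm_nonneg _)).1 h3
  · have h1 : ∀ i, inner ℂ (e i) (U (X (e i))) = (σ i : ℂ) := by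
      intro i
      simp only [U, LinearMap.sum_apply, ketBra_apply, inner_sum, inner_smul_right, e.inner_eq_ite]
      by_cases hi : σ i = 0
      · rw [hi]
        refine Finset.sum_eq_zero fun j _ => ?_
        have : i ≠ j := fun h => j.2 (h ▸ hi)
        simp [this]
      · rw [Finset.sum_eq_single ⟨i, hi⟩]
        · simp only [f, inner_smul_left, he, if_true, mul_one]
          change (starRingEnd ℂ) (σ i : ℂ)⁻¹ * (σ i : ℂ) ^ 2 = σ i
          have : (σ i : ℂ) ≠ 0 := by exact_mod_cast hi
          simp only [map_inv₀, Complex.conj_ofReal]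
          field_simp
        · intro j _ hj
          have : i ≠ j := fun h => hj (Subtype.ext h.symm)
          simp [this]
        · simp
    rw [LinearMap.trace_eq_sum_inner _ e, traceNorm_eq_sum]
    simp only [LinearMap.comp_apply, h1, hσ]
    push_cast
    rfl

/-- `V` and `W` are isometries with `V* W = s`. -/
structure IsometryPair (V W : A →ₗ[ℂ] B) (s : ℝ) : Prop where
  left : InnerScale V V 1
  right : InnerScale W W 1
  cross : InnerScale V W s

theorem IsometryPair.tensor {V W : A →ₗ[ℂ] B ⊗[ℂ] E} {V' : A' →ₗ[ℂ] B' ⊗[ℂ] E'} {s : ℝ}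
    (h : IsometryPair V W s) (h' : InnerScale V' V' 1)
    (eB : B ⊗[ℂ] B' ≃ₗᵢ[ℂ] B₁) (eE : E ⊗[ℂ] E' ≃ₗᵢ[ℂ] E₁) :
    IsometryPair (tensorDilation eB eE V V') (tensorDilation eB eE W V') s where
  left := by simpa using h.left.tensor h' eB eE
  right := by simpa using h.right.tensor h' eB eE
  cross := by simpa using h.cross.tensor h' eB eE

theorem InnerScale.norm_map {V : A →ₗ[ℂ] B} (h : InnerScale V V 1) (x : A) : ‖V x‖ = ‖x‖ := by
  have := h x x
  rw [one_mul, inner_self_complex, inner_self_complex] at this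
  exact (sq_eq_sq₀ (norm_nonneg _) (norm_nonneg _)).1 (Complex.ofReal_injective this)

/-- Expanding the square gives `1 + 1 - 2s`; as `V* W` is a scalar, this is an equality for every
vector. -/
theorem IsometryPair.norm_sub {V W : A →ₗ[ℂ] B} {s : ℝ} (h : IsometryPair V W s) (x : A) :
    ‖V x - W x‖ = √(2 * (1 - s)) * ‖x‖ := by
  have h1 : ‖V x - W x‖ ^ 2 = 2 * (1 - s) * ‖x‖ ^ 2 := by
    rw [@norm_sub_sq ℂ, h.left.norm_map, h.right.norm_map, h.cross x x,
      inner_self_complex, ← Complex.ofReal_mul, RCLike.re_eq_complex_re, Complex.ofReal_re]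
    ring
  rw [← Real.sqrt_sq (norm_nonneg (V x - W x)), h1, Real.sqrt_mul' _ (sq_nonneg _),
    Real.sqrt_sq (norm_nonneg x)]

/-- The Heisenberg picture: the dual of the map dilated by `V` is `U ↦ V* (U ⊗ 1) V`. -/
theorem Dilates.trace_comp {V : A →ₗ[ℂ] B ⊗[ℂ] E} {Φ : Op A →ₗ[ℂ] Op B} (h : Dilates V Φ)
    (U : Op B) (X : Op A) : LinearMap.trace ℂ B (U ∘ₗ Φ X) =
      LinearMap.trace ℂ A ((V.adjoint ∘ₗ TensorProduct.map U LinearMap.id ∘ₗ V) ∘ₗ X) := by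
  rw [h.apply, trace_comp_partialTrace, conj_apply]
  rw [← LinearMap.comp_assoc, ← LinearMap.comp_assoc, LinearMap.trace_comp_comm']
  simp only [LinearMap.comp_assoc]

/-- By duality it suffices to bound the form of `V* M V - W* M W`, where `M = U ⊗ 1` for a
contraction `U` that attains the trace norm. -/
theorem traceNorm_sub_le {V W : A →ₗ[ℂ] B ⊗[ℂ] E} {Φ Ψ : Op A →ₗ[ℂ] Op B} {s : ℝ}
    (hV : Dilates V Φ) (hW : Dilates W Ψ) (h : IsometryPair V W s) (X : Op A) :
    traceNorm (Φ X - Ψ X) ≤ 2 * √(2 * (1 - s)) * traceNorm X := by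
  obtain ⟨U, hU, hUt⟩ := exists_contraction_trace (Φ X - Ψ X)
  have hU' : ∀ z : B ⊗[ℂ] E, ‖TensorProduct.map U LinearMap.id z‖ ≤ ‖z‖ := by
    intro z
    have h1 : ‖LinearMap.toContinuousLinearMap U‖ ≤ 1 :=
      ContinuousLinearMap.opNorm_le_bound _ zero_le_one fun x => by simpa using hU x
    have h2 := (U.toContinuousLinearMap.rTensor E).le_opNorm z
    refine h2.trans ?_
    have h3 := ContinuousLinearMap.norm_rTensor_le (G := E) (U.toContinuousLinearMap)
    exact mul_le_of_le_one_left (norm_nonneg _) (h3.trans h1)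
  set M := TensorProduct.map U (LinearMap.id : E →ₗ[ℂ] E)
  have key : (traceNorm (Φ X - Ψ X) : ℂ) = LinearMap.trace ℂ A
      ((V.adjoint ∘ₗ M ∘ₗ V - W.adjoint ∘ₗ M ∘ₗ W) ∘ₗ X) := by
    rw [← hUt, LinearMap.comp_sub, map_sub, hV.trace_comp, hW.trace_comp, LinearMap.sub_comp,
      map_sub]
  have h2 := norm_trace_comp_le (V.adjoint ∘ₗ M ∘ₗ V - W.adjoint ∘ₗ M ∘ₗ W) X
    (2 * √(2 * (1 - s))) fun x y => ?_
  · rw [← key, Complex.norm_real, Real.norm_of_nonneg (traceNorm_nonneg _)] at h2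
    exact h2
  -- The splitting `V* M V - W* M W = V* M (V - W) + (V - W)* M W`; its two terms account for the
  -- factor 2.
  · have h3 : inner ℂ y ((V.adjoint ∘ₗ M ∘ₗ V - W.adjoint ∘ₗ M ∘ₗ W) x) =
        inner ℂ (V y) (M (V x - W x)) + inner ℂ (V y - W y) (M (W x)) := by
      simp only [LinearMap.sub_apply, LinearMap.comp_apply, inner_sub_right,
        LinearMap.adjoint_inner_right, map_sub, inner_sub_left]
      ring
    rw [h3]
    refine (norm_add_le _ _).trans ?_
    have h4 : ‖inner ℂ (V y) (M (V x - W x))‖ ≤ √(2 * (1 - s)) * ‖x‖ * ‖y‖ := by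
      refine (norm_inner_le_norm (𝕜 := ℂ) (E := B ⊗[ℂ] E) _ _).trans ?_
      rw [h.left.norm_map, mul_comm, ← h.norm_sub]
      exact mul_le_mul_of_nonneg_right (hU' _) (norm_nonneg _)
    have h5 : ‖inner ℂ (V y - W y) (M (W x))‖ ≤ √(2 * (1 - s)) * ‖x‖ * ‖y‖ := by
      refine (norm_inner_le_norm (𝕜 := ℂ) (E := B ⊗[ℂ] E) _ _).trans ?_
      rw [h.norm_sub, mul_right_comm _ ‖x‖]
      refine mul_le_mul_of_nonneg_left ((hU' _).trans ?_) (by positivity)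
      rw [h.right.norm_map]
    linarith

/-- Amplification by `id_n` does not change the overlap `s`, so the trace-norm bound is uniform in
`n`. -/
theorem diamondNorm_sub_le {V W : A →ₗ[ℂ] B ⊗[ℂ] E} {Φ Ψ : Op A →ₗ[ℂ] Op B} {s : ℝ}
    (hV : Dilates V Φ) (hW : Dilates W Ψ) (h : IsometryPair V W s) :
    diamondNorm (Φ - Ψ) ≤ ENNReal.ofReal (2 * √(2 * (1 - s))) := by
  refine iSup_le fun n => iSup_le fun X => iSup_le fun hX => ENNReal.ofReal_le_ofReal ?_
  have hid : InnerScale (TensorProduct.rid ℂ (EuclideanSpace ℂ (Fin n))).symm.toLinearMap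
      (TensorProduct.rid ℂ (EuclideanSpace ℂ (Fin n))).symm.toLinearMap 1 := fun x y => by simp
  have h1 : tensorMap (LinearMap.id : Op (EuclideanSpace ℂ (Fin n)) →ₗ[ℂ] _) (Φ - Ψ) X =
      tensorMap LinearMap.id Φ X - tensorMap LinearMap.id Ψ X := by
    rw [← LinearMap.sub_apply]
    congr 1
    refine linearMap_ext_map fun Y Z => ?_
    simp only [tensorMap_map, LinearMap.sub_apply]
    exact TensorProduct.ext' fun x y => by simp [TensorProduct.tmul_sub]
  rw [h1]
  have hp : IsometryPair
      (tensorDilation (.refl ℂ (EuclideanSpace ℂ (Fin n) ⊗[ℂ] B)) (TensorProduct.lidIsometry ℂ E)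
        (TensorProduct.rid ℂ (EuclideanSpace ℂ (Fin n))).symm.toLinearMap V)
      (tensorDilation (.refl ℂ (EuclideanSpace ℂ (Fin n) ⊗[ℂ] B)) (TensorProduct.lidIsometry ℂ E)
        (TensorProduct.rid ℂ (EuclideanSpace ℂ (Fin n))).symm.toLinearMap W) s :=
    ⟨by simpa using hid.tensor h.left _ _, by simpa using hid.tensor h.right _ _,
      by simpa using hid.tensor h.cross _ _⟩
  refine (traceNorm_sub_le (dilates_id.tensor hV _) (dilates_id.tensor hW _) hp X).trans ?_
  exact mul_le_of_le_one_right (by positivity) hX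

theorem buresDist_le {d : ℕ} {V W : A →ₗ[ℂ] B ⊗[ℂ] EuclideanSpace ℂ (Fin d)}
    {Φ Ψ : Op A →ₗ[ℂ] Op B} {s : ℝ}
    (hV : Dilates V Φ) (hW : Dilates W Ψ) (h : IsometryPair V W s) :
    buresDist Φ Ψ ≤ ENNReal.ofReal (√(2 * (1 - s))) := by
  let V₁ : A →ₗᵢ[ℂ] B ⊗[ℂ] EuclideanSpace ℂ (Fin d) := ⟨V, h.left.norm_map⟩
  let W₁ : A →ₗᵢ[ℂ] B ⊗[ℂ] EuclideanSpace ℂ (Fin d) := ⟨W, h.right.norm_map⟩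
  refine iInf_le_of_le d <| iInf_le_of_le V₁ <| iInf_le_of_le W₁ <| iInf_le_of_le hV.apply <|
      iInf_le_of_le hW.apply ?_
  rw [← ofReal_norm]
  refine ENNReal.ofReal_le_ofReal (ContinuousLinearMap.opNorm_le_bound _ (by positivity) ?_)
  intro x
  exact (h.norm_sub x).le

end Distances

/-! ### Existence of Stinespring isometries. -/

section Stinespring

set_option linter.unusedSectionVars false

variable {A B : Type*}
  [NormedAddCommGroup A] [InnerProductSpace ℂ A] [FiniteDimensional ℂ A]
  [NormedAddCommGroup B] [InnerProductSpace ℂ B] [FiniteDimensional ℂ B]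

/-- The trace of a rank-one operator is an inner product, so trace preservation on `|y⟩⟨x|` is the
isometry property. -/
theorem Dilates.innerScale {E : Type*} [NormedAddCommGroup E] [InnerProductSpace ℂ E]
    [FiniteDimensional ℂ E] {V : A →ₗ[ℂ] B ⊗[ℂ] E} {Φ : Op A →ₗ[ℂ] Op B} (h : Dilates V Φ)
    (hΦ : ∀ ρ : Op A, LinearMap.trace ℂ B (Φ ρ) = LinearMap.trace ℂ A ρ) : InnerScale V V 1 := by
  intro x y
  have := hΦ (ketBra y x)
  rw [h, trace_partialTrace, trace_ketBra, trace_ketBra] at this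
  rw [one_mul, this]

theorem exists_sum_ketBra {X : Op A} (hX : X.IsPositive) :
    ∃ (m : ℕ) (u : Fin m → A), X = ∑ i, ketBra (u i) (u i) := by
  have h : X.toContinuousLinearMap.IsPositive :=
    LinearMap.isPositive_toContinuousLinearMap_iff X |>.2 hX
  obtain ⟨m, u, hu⟩ := ContinuousLinearMap.isPositive_iff_eq_sum_rankOne.1 h
  refine ⟨m, u, LinearMap.ext fun x => ?_⟩
  have := congrArg (fun T : A →L[ℂ] A => T x) hu
  simpa using this

theorem isPositive_ketBra (x : A) : (ketBra x x).IsPositive :=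
  InnerProductSpace.isPositive_rankOne_self x |>.toLinearMap

/-- The partial inner product `b ⊗ y ↦ ⟨e, b⟩ y`. -/
def slice {H : Type*} [NormedAddCommGroup H] [InnerProductSpace ℂ H] (e : H) :
    H ⊗[ℂ] B →ₗ[ℂ] B :=
  (TensorProduct.lid ℂ B).toLinearMap ∘ₗ
    TensorProduct.map (innerSL ℂ e).toLinearMap LinearMap.id

@[simp] theorem slice_tmul {H : Type*} [NormedAddCommGroup H] [InnerProductSpace ℂ H] (e b : H)
    (y : B) : slice e (b ⊗ₜ[ℂ] y) = inner ℂ e b • y := by simp [slice]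

theorem inner_slice {H : Type*} [NormedAddCommGroup H] [InnerProductSpace ℂ H] (e : H)
    (u : H ⊗[ℂ] B) (y : B) : inner ℂ (slice e u) y = inner ℂ u (e ⊗ₜ y) := by
  induction u using TensorProduct.induction_on with
  | zero => simp
  | add x y hx hy => simp only [map_add, inner_add_left, hx, hy]
  | tmul b z => simp [mul_comm]

/-- Every quantum channel has a Stinespring isometry with a finite-dimensional environment. -/
theorem IsQuantumChannel.exists_dilates {Φ : Op A →ₗ[ℂ] Op B} (h : IsQuantumChannel Φ) :
    ∃ (d : ℕ) (V : A →ₗ[ℂ] B ⊗[ℂ] EuclideanSpace ℂ (Fin d)),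
      Dilates V Φ ∧ InnerScale V V 1 := by
  set n := Module.finrank ℂ A
  let a : OrthonormalBasis (Fin n) ℂ A := stdOrthonormalBasis ℂ A
  let e : OrthonormalBasis (Fin n) ℂ (EuclideanSpace ℂ (Fin n)) := EuclideanSpace.basisFun _ ℂ
  -- Choi's argument: the image of the unnormalized maximally entangled state is positive, hence a
  -- sum of rank-one operators `|u_k⟩⟨u_k|`. The slices of `u_k` are the columns of the `k`-th Kraus
  -- operator.
  have hpos := h.completelyPositive n _ (isPositive_ketBra (∑ i, e i ⊗ₜ[ℂ] a i))
  obtain ⟨d, u, hu⟩ := exists_sum_ketBra hpos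
  have hval (i j : Fin n) : Φ (ketBra (a i) (a j)) =
      ∑ k, ketBra (slice (e i) (u k)) (slice (e j) (u k)) := by
    refine LinearMap.ext fun y => ?_
    -- Compression to the block `(i, j)` of the Choi matrix recovers `Φ(|a_i⟩⟨a_j|)`.
    have h1 := congrArg (fun T => slice (e i) (T (e j ⊗ₜ y))) hu
    simp only [ketBra_sum_left, ketBra_sum_right, ketBra_tmul, map_sum, tensorMap_map,
      LinearMap.sum_apply, TensorProduct.map_tmul, LinearMap.id_apply, slice_tmul, ketBra_apply,
      e.inner_eq_ite, inner_smul_right, map_smul, ← inner_slice] at h1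
    simpa using h1
  let V : A →ₗ[ℂ] B ⊗[ℂ] EuclideanSpace ℂ (Fin d) :=
    a.toBasis.constr ℂ fun i => ∑ k, slice (e i) (u k) ⊗ₜ EuclideanSpace.basisFun (Fin d) ℂ k
  have hV (i : Fin n) : V (a i) = ∑ k, slice (e i) (u k) ⊗ₜ EuclideanSpace.basisFun (Fin d) ℂ k := by
    rw [← a.coe_toBasis, Module.Basis.constr_basis]
  have hd (i j : Fin n) :
      Φ (ketBra (a i) (a j)) = partialTrace B _ (ketBra (V (a i)) (V (a j))) := by
    rw [hval, hV, hV]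
    simp only [ketBra_sum_left, ketBra_sum_right, ketBra_tmul, map_sum, partialTrace_map,
      trace_ketBra, OrthonormalBasis.inner_eq_ite]
    simp
  have hD : Dilates V Φ := by
    have hlin : Φ = partialTrace B _ ∘ₗ conj V := by
      refine linearMap_ext_ketBra fun x y => ?_
      rw [← a.sum_repr x, ← a.sum_repr y]
      have hs : ∀ (c c' : Fin n → ℂ), ketBra (∑ i, c i • a i) (∑ i, c' i • a i) =
          ∑ i, ∑ j, (c i * starRingEnd ℂ (c' j)) • ketBra (a i) (a j) := by
        intro c c'
        simp only [ketBra_sum_left, ketBra_sum_right]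
        refine Finset.sum_comm.trans (Finset.sum_congr rfl fun i _ => Finset.sum_congr rfl
          fun j _ => LinearMap.ext fun z => ?_)
        simp [smul_smul]
        ring_nf
      rw [hs]
      simp only [map_sum, map_smul, hd, LinearMap.comp_apply, conj_apply,
        comp_ketBra_comp_adjoint]
    refine dilates_of_apply fun ρ => ?_
    exact LinearMap.congr_fun hlin ρ
  exact ⟨d, V, hD, hD.innerScale h.tracePreserving⟩

theorem dist_tensorMap_le {E A' B' : Type*} [NormedAddCommGroup E] [InnerProductSpace ℂ E]
    [FiniteDimensional ℂ E]
    [NormedAddCommGroup A'] [InnerProductSpace ℂ A'] [FiniteDimensional ℂ A']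
    [NormedAddCommGroup B'] [InnerProductSpace ℂ B'] [FiniteDimensional ℂ B']
    {V W : A →ₗ[ℂ] B ⊗[ℂ] E} {Φ Ψ : Op A →ₗ[ℂ] Op B} {s : ℝ}
    (hV : Dilates V Φ) (hW : Dilates W Ψ) (h : IsometryPair V W s)
    {Φ' : Op A' →ₗ[ℂ] Op B'} (hΦ' : IsQuantumChannel Φ') :
    buresDist (tensorMap Φ Φ') (tensorMap Ψ Φ') ≤ ENNReal.ofReal (√(2 * (1 - s))) ∧
      diamondNorm (tensorMap Φ Φ' - tensorMap Ψ Φ') ≤ ENNReal.ofReal (2 * √(2 * (1 - s))) := by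
  obtain ⟨d, V', hV', hI⟩ := hΦ'.exists_dilates
  -- The Bures distance asks for environments of the form `ℂ^d`, so the product environment is put
  -- into coordinates.
  let eE := (stdOrthonormalBasis ℂ (E ⊗[ℂ] EuclideanSpace ℂ (Fin d))).repr
  have hp := h.tensor hI (.refl ℂ (B ⊗[ℂ] B')) eE
  exact ⟨buresDist_le (hV.tensor hV' eE) (hW.tensor hV' eE) hp,
    diamondNorm_sub_le (hV.tensor hV' eE) (hW.tensor hV' eE) hp⟩

end Stinespring

/-! ### Letters, reversal, and the Temperley–Lieb relations. -/

section Words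

variable {N : ℕ}

/-! ### Creation and annihilation of the first letter -/

/-- `f ↦ |c⟩ ⊗ f`. -/
def create {n : ℕ} (c : Fin N) : TensorPow N n →ₗ[ℂ] TensorPow N (n + 1) where
  toFun f := WithLp.toLp 2 fun x => if x 0 = c then f (Fin.tail x) else 0
  map_add' f g := by
    ext x
    by_cases h : x 0 = c <;> simp [h]
  map_smul' a f := by
    ext x
    simp

/-- `f ↦ (⟨c| ⊗ id) f`. -/
def annih {n : ℕ} (c : Fin N) : TensorPow N (n + 1) →ₗ[ℂ] TensorPow N n where
  toFun f := WithLp.toLp 2 fun x => f (Fin.cons c x : Fin (n + 1) → Fin N)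
  map_add' f g := by
    ext x
    simp
  map_smul' a f := by
    ext x
    simp

theorem create_apply {n : ℕ} (c : Fin N) (f : TensorPow N n) (x : Fin (n + 1) → Fin N) :
    create c f x = if x 0 = c then f (Fin.tail x) else 0 := rfl

theorem annih_apply {n : ℕ} (c : Fin N) (f : TensorPow N (n + 1)) (x : Fin n → Fin N) :
    annih c f x = f (Fin.cons c x : Fin (n + 1) → Fin N) := rfl

theorem annih_create {n : ℕ} (d c : Fin N) (f : TensorPow N n) :
    annih d (create c f) = if d = c then f else 0 := by
  ext x
  rw [annih_apply, create_apply]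
  by_cases h : d = c <;> simp [h]

theorem linearMap_ite {m n : ℕ} (T : TensorPow N m →ₗ[ℂ] TensorPow N n) (p : Prop) [Decidable p]
    (f : TensorPow N m) : T (if p then f else 0) = if p then T f else 0 := by
  rw [apply_ite T, map_zero]

theorem sum_create_annih {n : ℕ} (f : TensorPow N (n + 1)) : ∑ c, create c (annih c f) = f := by
  ext x
  simp [create_apply, annih_apply]

theorem sum_words {M : Type*} [AddCommMonoid M] {n : ℕ} (g : (Fin (n + 1) → Fin N) → M) :
    ∑ x, g x = ∑ c, ∑ x : Fin n → Fin N, g (Fin.cons c x) := by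
  rw [← (Fin.consEquiv fun _ => Fin N).sum_comp, Fintype.sum_prod_type]
  rfl

theorem inner_create {n : ℕ} (c : Fin N) (f : TensorPow N n) (g : TensorPow N (n + 1)) :
    inner ℂ (create c f) g = inner ℂ f (annih c g) := by
  simp only [PiLp.inner_apply, sum_words, create_apply, annih_apply, Fin.cons_zero, Fin.tail_cons]
  rw [Finset.sum_eq_single c]
  · simp
  · intro b _ hb
    simp [hb]
  · simp

theorem inner_create_right {n : ℕ} (c : Fin N) (f : TensorPow N n) (g : TensorPow N (n + 1)) :
    inner ℂ g (create c f) = inner ℂ (annih c g) f := by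
  rw [← inner_conj_symm, inner_create, inner_conj_symm]

theorem ket_apply {n : ℕ} (x y : Fin n → Fin N) : ket x y = if y = x then 1 else 0 := by
  simp [ket]

theorem create_ket {n : ℕ} (c : Fin N) (x : Fin n → Fin N) :
    create c (ket x) = ket (Fin.cons c x : Fin (n + 1) → Fin N) := by
  ext y
  rw [create_apply, ket_apply, ket_apply]
  obtain ⟨d, y, rfl⟩ : ∃ d y', y = Fin.cons d y' := ⟨y 0, Fin.tail y, (Fin.cons_self_tail y).symm⟩
  simp only [Fin.cons_zero, Fin.tail_cons, Fin.cons_inj]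
  by_cases h : d = c <;> simp [h]

theorem sum_ket {n : ℕ} (f : TensorPow N n) : f = ∑ x, f x • ket x := by
  ext y
  simp [ket_apply]

/-! ### Reversal of words -/

/-- The reversal of words, `|x_0 ⋯ x_{n-1}⟩ ↦ |x_{n-1} ⋯ x_0⟩`. -/
def reverse {n : ℕ} : TensorPow N n →ₗ[ℂ] TensorPow N n where
  toFun f := WithLp.toLp 2 fun x => f (x ∘ Fin.rev)
  map_add' f g := by
    ext x
    simp
  map_smul' a f := by
    ext x
    simp

theorem reverse_apply {n : ℕ} (f : TensorPow N n) (x : Fin n → Fin N) :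
    reverse f x = f (x ∘ Fin.rev) := rfl

@[simp] theorem comp_rev_rev {n : ℕ} (x : Fin n → Fin N) : (x ∘ Fin.rev) ∘ Fin.rev = x := by
  ext i; simp

@[simp] theorem reverse_reverse {n : ℕ} (f : TensorPow N n) : reverse (reverse f) = f := by
  ext x
  simp [reverse_apply]

/-- Reversal as a permutation of words. -/
def revEquiv (N n : ℕ) : (Fin n → Fin N) ≃ (Fin n → Fin N) :=
  Function.Involutive.toPerm (fun x => x ∘ Fin.rev) fun x => comp_rev_rev x

@[simp] theorem revEquiv_apply {n : ℕ} (x : Fin n → Fin N) : revEquiv N n x = x ∘ Fin.rev := rfl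

theorem inner_reverse {n : ℕ} (f g : TensorPow N n) :
    inner ℂ (reverse f) g = inner ℂ f (reverse g) := by
  simp only [PiLp.inner_apply, reverse_apply]
  rw [← (revEquiv N n).sum_comp]
  simp

theorem reverse_ket {n : ℕ} (x : Fin n → Fin N) : reverse (ket x) = ket (x ∘ Fin.rev) := by
  ext y
  rw [reverse_apply, ket_apply, ket_apply]
  have : y ∘ Fin.rev = x ↔ y = x ∘ Fin.rev := by
    constructor
    · rintro rfl; simp
    · rintro rfl; simp
  simp [this]

/-- `f ↦ f ⊗ |c⟩`. -/
def createLast {n : ℕ} (c : Fin N) : TensorPow N n →ₗ[ℂ] TensorPow N (n + 1) :=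
  reverse ∘ₗ create c ∘ₗ reverse

/-- `f ↦ (id ⊗ ⟨c|) f`. -/
def annihLast {n : ℕ} (c : Fin N) : TensorPow N (n + 1) →ₗ[ℂ] TensorPow N n :=
  reverse ∘ₗ annih c ∘ₗ reverse

theorem createLast_apply {n : ℕ} (c : Fin N) (f : TensorPow N n) :
    createLast c f = reverse (create c (reverse f)) := rfl

theorem annihLast_apply {n : ℕ} (c : Fin N) (f : TensorPow N (n + 1)) :
    annihLast c f = reverse (annih c (reverse f)) := rfl

theorem inner_createLast {n : ℕ} (c : Fin N) (f : TensorPow N n) (g : TensorPow N (n + 1)) :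
    inner ℂ (createLast c f) g = inner ℂ f (annihLast c g) := by
  rw [createLast_apply, annihLast_apply, inner_reverse, inner_create, inner_reverse]

theorem createLast_ket {n : ℕ} (c : Fin N) (x : Fin n → Fin N) :
    createLast c (ket x) = ket (Fin.snoc x c : Fin (n + 1) → Fin N) := by
  rw [createLast_apply, reverse_ket, create_ket, reverse_ket]
  congr 1
  ext i
  refine Fin.lastCases ?_ (fun j => ?_) i
  · simp
  · simp [Fin.rev_castSucc]

/-! ### Cups and caps -/

/-- The insertion of `∑ c, |c c⟩` after the first `i` letters. -/
def cup (N : ℕ) : (n i : ℕ) → TensorPow N n →ₗ[ℂ] TensorPow N (n + 2)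
  | _, 0 => ∑ c, create c ∘ₗ create c
  | 0, _ + 1 => 0
  | n + 1, i + 1 => ∑ c, create c ∘ₗ cup N n i ∘ₗ annih c

/-- The contraction of the two letters which follow the first `i` ones. -/
def cap (N : ℕ) : (n i : ℕ) → TensorPow N (n + 2) →ₗ[ℂ] TensorPow N n
  | _, 0 => ∑ c, annih c ∘ₗ annih c
  | 0, _ + 1 => 0
  | n + 1, i + 1 => ∑ c, create c ∘ₗ cap N n i ∘ₗ annih c

theorem cup_zero {n : ℕ} (f : TensorPow N n) : cup N n 0 f = ∑ c, create c (create c f) := by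
  cases n <;> simp [cup]

theorem cap_zero {n : ℕ} (f : TensorPow N (n + 2)) : cap N n 0 f = ∑ c, annih c (annih c f) := by
  cases n <;> simp [cap]

theorem cup_succ {n : ℕ} (i : ℕ) (f : TensorPow N (n + 1)) :
    cup N (n + 1) (i + 1) f = ∑ c, create c (cup N n i (annih c f)) := by
  simp [cup]

theorem cap_succ {n : ℕ} (i : ℕ) (f : TensorPow N (n + 1 + 2)) :
    cap N (n + 1) (i + 1) f = ∑ c, create c (cap N n i (annih c f)) := by
  simp [cap]

/-- Positions beyond the end of the word give the zero map, so later inductions need no bound on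
`i`. -/
theorem cup_zero_succ (i : ℕ) : cup N 0 (i + 1) = 0 := rfl

theorem cap_zero_succ (i : ℕ) : cap N 0 (i + 1) = 0 := rfl

theorem annih_cup_succ {n : ℕ} (i : ℕ) (c : Fin N) (f : TensorPow N (n + 1)) :
    annih c (cup N (n + 1) (i + 1) f) = cup N n i (annih c f) := by
  simp [cup_succ, annih_create]

theorem annih_cap_succ {n : ℕ} (i : ℕ) (c : Fin N) (f : TensorPow N (n + 1 + 2)) :
    annih c (cap N (n + 1) (i + 1) f) = cap N n i (annih c f) := by
  simp [cap_succ, annih_create]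

theorem inner_cup : ∀ (n i : ℕ) (f : TensorPow N n) (g : TensorPow N (n + 2)),
    inner ℂ (cup N n i f) g = inner ℂ f (cap N n i g)
  | _, 0, f, g => by simp only [cup_zero, cap_zero, inner_create, sum_inner, inner_sum]
  | 0, _ + 1, f, g => by simp [cup_zero_succ, cap_zero_succ]
  | n + 1, i + 1, f, g => by
    simp only [cup_succ, cap_succ, sum_inner, inner_sum]
    refine Finset.sum_congr rfl fun c _ => ?_
    rw [inner_create, inner_cup n i, inner_create_right]

/-- The operators which are scalars or have the form `cup ∘ cap`. -/
inductive IsCupCap (N : ℕ) : (n : ℕ) → (TensorPow N n →ₗ[ℂ] TensorPow N n) → Prop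
  | scalar (n : ℕ) (c : ℂ) : IsCupCap N n (c • LinearMap.id)
  | comp (n i j : ℕ) : IsCupCap N (n + 2) (cup N n j ∘ₗ cap N n i)

/-- An untouched first letter moves all positions by one. -/
theorem IsCupCap.shift {n : ℕ} {T : TensorPow N n →ₗ[ℂ] TensorPow N n} (h : IsCupCap N n T) :
    IsCupCap N (n + 1) (∑ c, create c ∘ₗ T ∘ₗ annih c) := by
  cases h with
  | scalar _ c =>
    convert IsCupCap.scalar (N := N) (n + 1) c
    ext1 f
    simp [← Finset.smul_sum, sum_create_annih]
  | comp n i j =>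
    convert IsCupCap.comp (N := N) (n + 1) (i + 1) (j + 1)
    ext1 f
    simp [cup_succ, annih_cap_succ]

/-- The Temperley–Lieb relations: a closed loop gives `N`, adjacent positions straighten to the
identity, distant ones commute past each other, and positions out of range give the scalar 0. -/
theorem isCupCap_cap_cup : ∀ n i j : ℕ, IsCupCap N n (cap N n i ∘ₗ cup N n j)
  | n, 0, 0 => by
    convert IsCupCap.scalar (N := N) n N
    ext1 f
    simp [cup_zero, cap_zero, annih_create, linearMap_ite, Nat.cast_smul_eq_nsmul]
  | 0, 0, j + 1 => by
    convert IsCupCap.scalar (N := N) 0 0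
    simp [cup_zero_succ]
  | 0, i + 1, j => by
    convert IsCupCap.scalar (N := N) 0 0
    simp [cap_zero_succ]
  | n + 1, i + 1, j + 1 => by
    convert (isCupCap_cap_cup n i j).shift
    ext1 f
    simp [cap_succ, annih_cup_succ]
  | n + 1, 0, 1 => by
    convert IsCupCap.scalar (N := N) (n + 1) 1
    ext1 f
    simp [cap_zero, annih_cup_succ, cup_zero, annih_create, sum_create_annih]
  | n + 1, 1, 0 => by
    convert IsCupCap.scalar (N := N) (n + 1) 1
    ext1 f
    simp [cap_succ, cap_zero, cup_zero, annih_create, linearMap_ite, sum_create_annih]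
  | 1, 0, j + 2 => by
    convert IsCupCap.scalar (N := N) 1 0
    ext1 f
    simp [cup_succ, cup_zero_succ]
  | 1, i + 2, 0 => by
    convert IsCupCap.scalar (N := N) 1 0
    ext1 f
    simp [cap_succ, cap_zero_succ]
  | n + 2, 0, j + 2 => by
    convert IsCupCap.comp (N := N) n 0 j
    ext1 f
    simp [cap_zero, annih_cup_succ]
  | n + 2, i + 2, 0 => by
    convert IsCupCap.comp (N := N) n i 0
    ext1 f
    simp [cap_succ, cup_zero, annih_create, linearMap_ite]

end Words

/-! ### Linear functionals on the quotient algebra -/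

/-- A linear functional on an algebra which is compatible with the two-sided ideal generated by a
relation descends to the quotient. -/
theorem exists_functional_ringQuot {R : Type*} [Ring R] [Algebra ℂ R] {r : R → R → Prop}
    (φ : R →ₗ[ℂ] ℂ) (hφ : ∀ a b, r a b → ∀ x y, φ (x * a * y) = φ (x * b * y)) :
    ∃ ψ : RingQuot r →ₗ[ℂ] ℂ, ∀ a, ψ (RingQuot.mkAlgHom ℂ r a) = φ a := by
  -- The functionals that respect the relation are stable under the translations `χ ↦ χ(· a)`. This
  -- action of `R` on `X` factors through the quotient, and `φ` is recovered as `a ↦ (a · φ)(1)`.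
  let X : Submodule ℂ (R →ₗ[ℂ] ℂ) :=
    { carrier := {χ | ∀ a b, r a b → ∀ x y, χ (x * a * y) = χ (x * b * y)}
      zero_mem' := fun a b _ x y => rfl
      add_mem' := fun h h' a b hab x y => by
        rw [LinearMap.add_apply, LinearMap.add_apply, h a b hab, h' a b hab]
      smul_mem' := fun c χ h a b hab x y => by
        rw [LinearMap.smul_apply, LinearMap.smul_apply, h a b hab] }
  let act (a : R) : X →ₗ[ℂ] X :=
    { toFun := fun χ => ⟨χ.1 ∘ₗ LinearMap.mulRight ℂ a, fun b c hbc x y => by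
        simpa [mul_assoc] using χ.2 b c hbc x (y * a)⟩
      map_add' := fun _ _ => rfl
      map_smul' := fun _ _ => rfl }
  have hact (a : R) (χ : X) (x : R) : (act a χ).1 x = χ.1 (x * a) := rfl
  let ρ : R →ₐ[ℂ] Module.End ℂ X :=
    { toFun := act
      map_one' := by ext χ x; simp [hact]
      map_mul' := fun a b => by ext χ x; simp [hact, mul_assoc]
      map_zero' := by ext χ x; simp [hact]
      map_add' := fun a b => by ext χ x; simp [hact, mul_add]
      commutes' := fun c => by
        ext χ x
        simp [hact, Algebra.algebraMap_eq_smul_one] }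
  have hρ : ∀ ⦃a b⦄, r a b → ρ a = ρ b := fun a b hab => by
    ext χ x
    change χ.1 (x * a) = χ.1 (x * b)
    simpa using χ.2 a b hab x 1
  let φX : X := ⟨φ, hφ⟩
  let ev : Module.End ℂ X →ₗ[ℂ] ℂ :=
    { toFun := fun T => (T φX).1 1
      map_add' := fun _ _ => rfl
      map_smul' := fun _ _ => rfl }
  refine ⟨ev ∘ₗ (RingQuot.liftAlgHom ℂ ⟨ρ, hρ⟩).toLinearMap, fun a => ?_⟩
  change ev (RingQuot.liftAlgHom ℂ ⟨ρ, hρ⟩ (RingQuot.mkAlgHom ℂ r a)) = φ a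
  rw [RingQuot.liftAlgHom_mkAlgHom_apply]
  change φ (1 * a) = φ a
  rw [one_mul]

theorem basisFreeMonoid_apply {X : Type*} (w : FreeMonoid X) :
    FreeAlgebra.basisFreeMonoid ℂ X w = (w.toList.map (FreeAlgebra.ι ℂ)).prod := by
  rw [FreeAlgebra.basisFreeMonoid]
  have : FreeAlgebra.equivMonoidAlgebraFreeMonoid.symm (MonoidAlgebra.of ℂ (FreeMonoid X) w) =
      FreeMonoid.lift (FreeAlgebra.ι ℂ) w := by
    simp [FreeAlgebra.equivMonoidAlgebraFreeMonoid]
  rw [← FreeMonoid.lift_apply, ← this]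
  rfl

/-! ### Every intertwiner commutes with the projections onto cup spans. -/

section Intertwiners

variable {N : ℕ}

/-! ### Spaces stable under cups and caps -/

/-- If `T` maps `M` into `M'` and its adjoint maps `M'` into `M`, then `T` also respects the
orthogonal complements. -/
theorem starProjection_comm {H K : Type*} [NormedAddCommGroup H] [InnerProductSpace ℂ H]
    [NormedAddCommGroup K] [InnerProductSpace ℂ K] {M : Submodule ℂ H} {M' : Submodule ℂ K}
    [M.HasOrthogonalProjection] [M'.HasOrthogonalProjection] {T : H →ₗ[ℂ] K} {S : K →ₗ[ℂ] H}
    (hTS : ∀ f g, inner ℂ (T f) g = inner ℂ f (S g)) (hT : ∀ f ∈ M, T f ∈ M')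
    (hS : ∀ g ∈ M', S g ∈ M) (f : H) : M'.starProjection (T f) = T (M.starProjection f) := by
  refine Submodule.eq_starProjection_of_mem_of_inner_eq_zero
    (hT _ (M.starProjection_apply_mem f)) fun w hw => ?_
  rw [← map_sub, hTS]
  exact M.starProjection_inner_eq_zero f _ (hS w hw)

/-- The vectors which are killed by all caps. -/
def capKernel (N : ℕ) : (n : ℕ) → Submodule ℂ (TensorPow N n)
  | 0 => ⊤
  | 1 => ⊤
  | n + 2 => ⨅ i, LinearMap.ker (cap N n i)

theorem mem_capKernel {n : ℕ} {f : TensorPow N (n + 2)} :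
    f ∈ capKernel N (n + 2) ↔ ∀ i, cap N n i f = 0 := by
  simp [capKernel]

/-- The vectors of `H_1^{⊗ p}` which are obtained from the kernel of the caps in `H_1^{⊗ n}` by
inserting cups. -/
def cupSpan (N n : ℕ) : (p : ℕ) → Submodule ℂ (TensorPow N p)
  | 0 => if 0 = n then capKernel N 0 else ⊥
  | 1 => if 1 = n then capKernel N 1 else ⊥
  | p + 2 => (if p + 2 = n then capKernel N (p + 2) else ⊥) ⊔ ⨆ j, (cupSpan N n p).map (cup N p j)

theorem cup_mem_cupSpan {n p : ℕ} (j : ℕ) {f : TensorPow N p} (hf : f ∈ cupSpan N n p) :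
    cup N p j f ∈ cupSpan N n (p + 2) :=
  Submodule.mem_sup_right (Submodule.mem_iSup_of_mem j (Submodule.mem_map_of_mem hf))

/-- By the Temperley–Lieb relations, a cap meeting a cup either leaves a scalar or passes to the
other side, where induction on `p` applies; on the generating vectors it vanishes. -/
theorem cap_mem_cupSpan (n : ℕ) : ∀ (p i : ℕ) (f : TensorPow N (p + 2)),
    f ∈ cupSpan N n (p + 2) → cap N p i f ∈ cupSpan N n p
  | p, i, f, hf => by
    have h : cupSpan N n (p + 2) ≤ (cupSpan N n p).comap (cap N p i) := by
      refine sup_le ?_ (iSup_le fun j => ?_)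
      · split_ifs with hp
        · intro g hg
          rw [Submodule.mem_comap, mem_capKernel.1 hg i]
          exact zero_mem _
        · exact bot_le
      · rintro _ ⟨g, hg, rfl⟩
        rw [Submodule.mem_comap]
        change (cap N p i ∘ₗ cup N p j) g ∈ _
        have hc := isCupCap_cap_cup (N := N) p i j
        generalize cap N p i ∘ₗ cup N p j = T at hc
        cases hc with
        | scalar _ c => exact Submodule.smul_mem _ _ hg
        | comp q i' j' => exact cup_mem_cupSpan j' (cap_mem_cupSpan n q i' g hg)
    exact h hf

/-- Cups only raise the degree, and the generating vectors sit in degree `n`. -/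
theorem cupSpan_eq_bot (n : ℕ) : ∀ p : ℕ, p < n → cupSpan N n p = ⊥
  | 0, h => by simp [cupSpan, h.ne]
  | 1, h => by simp [cupSpan, h.ne]
  | p + 2, h => by simp [cupSpan, h.ne, cupSpan_eq_bot n p (by omega)]

theorem capKernel_le_cupSpan : ∀ n : ℕ, capKernel N n ≤ cupSpan N n n
  | 0 => by simp [cupSpan]
  | 1 => by simp [cupSpan]
  | n + 2 => by
    rw [cupSpan, if_pos rfl]
    exact le_sup_left

/-- The orthogonal projection onto `cupSpan`. -/
def cupProj (N n p : ℕ) : TensorPow N p →ₗ[ℂ] TensorPow N p :=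
  (cupSpan N n p).starProjection.toLinearMap

theorem cupProj_cup (n p i : ℕ) (f : TensorPow N p) :
    cupProj N n (p + 2) (cup N p i f) = cup N p i (cupProj N n p f) :=
  starProjection_comm (inner_cup p i) (fun _ => cup_mem_cupSpan i)
    (fun g hg => cap_mem_cupSpan n p i g hg) f

theorem cap_cupProj (n p i : ℕ) (f : TensorPow N (p + 2)) :
    cap N p i (cupProj N n (p + 2) f) = cupProj N n p (cap N p i f) := by
  refine (starProjection_comm (fun f g => ?_) (fun g hg => cap_mem_cupSpan n p i g hg)
    (fun _ => cup_mem_cupSpan i) f).symm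
  rw [← inner_conj_symm, ← inner_cup, inner_conj_symm]

/-! ### Basis vectors indexed by lists -/

/-- The basis vector of `H_1^{⊗ p}` given by a list of length `p`; zero for other lists. -/
def ketList (N : ℕ) : (p : ℕ) → List (Fin N) → TensorPow N p
  | 0, [] => ket Fin.elim0
  | 0, _ :: _ => 0
  | _ + 1, [] => 0
  | p + 1, c :: l => create c (ketList N p l)

theorem ketList_ofFn : ∀ {n : ℕ} (x : Fin n → Fin N), ketList N n (List.ofFn x) = ket x
  | 0, x => by
    rw [List.ofFn_zero, ketList]
    congr 1
    exact Subsingleton.elim _ _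
  | n + 1, x => by
    rw [List.ofFn_succ, ketList, ketList_ofFn, create_ket]
    congr 1
    exact Fin.cons_self_tail x

theorem ketList_eq_zero : ∀ (p : ℕ) (l : List (Fin N)), l.length ≠ p → ketList N p l = 0
  | 0, [], h => by simp at h
  | 0, _ :: _, _ => rfl
  | _ + 1, [], _ => rfl
  | p + 1, c :: l, h => by
    rw [ketList, ketList_eq_zero p l (by simpa using h), map_zero]

theorem cup_ketList : ∀ (p : ℕ) (u v : List (Fin N)), cup N p u.length (ketList N p (u ++ v)) =
    ∑ k, ketList N (p + 2) (u ++ k :: k :: v)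
  | p, [], v => by simp [cup_zero, ketList]
  | 0, c :: u, v => by
    rw [Finset.sum_eq_zero]
    · simp [cup_zero_succ]
    · intro k _
      apply ketList_eq_zero
      simp
      omega
  | p + 1, c :: u, v => by
    simp only [List.length_cons, List.cons_append, ketList, cup_succ, annih_create, linearMap_ite,
      cup_ketList p u v, map_sum]
    simp

theorem cap_ketList : ∀ (p : ℕ) (u v : List (Fin N)) (i j : Fin N),
    cap N p u.length (ketList N (p + 2) (u ++ i :: j :: v)) =
      if i = j then ketList N p (u ++ v) else 0
  | p, [], v, i, j => by
    simp only [List.length_nil, List.nil_append, ketList, cap_zero, annih_create, linearMap_ite]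
    simp
  | 0, c :: u, v, i, j => by
    simp [cap_zero_succ, ketList]
  | p + 1, c :: u, v, i, j => by
    simp only [List.length_cons, List.cons_append, ketList, cap_succ, annih_create, linearMap_ite,
      cap_ketList p u v]
    simp

/-! ### The functional which picks out the top component -/

/-- The functional on the free algebra whose values on words are the matrix elements of
`cupProj`. -/
def topFunctional (N n : ℕ) : FreeAlgebra ℂ (Fin N × Fin N) →ₗ[ℂ] ℂ :=
  (FreeAlgebra.basisFreeMonoid ℂ (Fin N × Fin N)).constr ℂ fun w =>
    inner ℂ (ketList N w.toList.length (w.toList.map Prod.fst))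
      (cupProj N n w.toList.length (ketList N w.toList.length (w.toList.map Prod.snd)))

theorem topFunctional_prod (n : ℕ) (l : List (Fin N × Fin N)) :
    topFunctional N n (l.map (FreeAlgebra.ι ℂ)).prod =
      inner ℂ (ketList N l.length (l.map Prod.fst))
        (cupProj N n l.length (ketList N l.length (l.map Prod.snd))) := by
  have := basisFreeMonoid_apply (FreeMonoid.ofList l)
  rw [FreeMonoid.toList_ofList] at this
  rw [← this, topFunctional, Module.Basis.constr_basis, FreeMonoid.toList_ofList]

theorem topFunctional_word_mul (n : ℕ) (u v : List (Fin N × Fin N)) (i j i' j' : Fin N) :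
    topFunctional N n ((u.map (FreeAlgebra.ι ℂ)).prod * (FreeAlgebra.ι ℂ (i, j) *
      FreeAlgebra.ι ℂ (i', j')) * (v.map (FreeAlgebra.ι ℂ)).prod) =
      inner ℂ (ketList N ((u ++ v).length + 2) (u.map Prod.fst ++ i :: i' :: v.map Prod.fst))
        (cupProj N n _
          (ketList N ((u ++ v).length + 2) (u.map Prod.snd ++ j :: j' :: v.map Prod.snd))) := by
  have h := topFunctional_prod n (u ++ (i, j) :: (i', j') :: v)
  have hl : (u ++ (i, j) :: (i', j') :: v).length = (u ++ v).length + 2 := by simp; omega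
  rw [hl] at h
  simpa [mul_assoc] using h

theorem topFunctional_word (n : ℕ) (u v : List (Fin N × Fin N)) :
    topFunctional N n ((u.map (FreeAlgebra.ι ℂ)).prod * (v.map (FreeAlgebra.ι ℂ)).prod) =
      inner ℂ (ketList N (u ++ v).length (u.map Prod.fst ++ v.map Prod.fst))
        (cupProj N n _ (ketList N (u ++ v).length (u.map Prod.snd ++ v.map Prod.snd))) := by
  have h := topFunctional_prod n (u ++ v)
  simpa using h

/-- A sum over a repeated index in `u uᵗ` or `uᵗ u` inserts a cup into one of the two words. The cup
passes through `cupProj`, and becomes by adjunction a cap on the other word, which produces `δ_ij`.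
-/
theorem topFunctional_rel (n : ℕ) {a b : FreeAlgebra ℂ (Fin N × Fin N)} (h : OPlusRel N a b)
    (x y : FreeAlgebra ℂ (Fin N × Fin N)) :
    topFunctional N n (x * a * y) = topFunctional N n (x * b * y) := by
  let bs := FreeAlgebra.basisFreeMonoid ℂ (Fin N × Fin N)
  let L (c : FreeAlgebra ℂ (Fin N × Fin N)) :
      FreeAlgebra ℂ (Fin N × Fin N) →ₗ[ℂ] FreeAlgebra ℂ (Fin N × Fin N) →ₗ[ℂ] ℂ :=
    ((LinearMap.mul ℂ _).comp (LinearMap.mulRight ℂ c)).compr₂ (topFunctional N n)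
  suffices hL : L a = L b from LinearMap.congr_fun (LinearMap.congr_fun hL x) y
  refine bs.ext fun u => bs.ext fun v => ?_
  change topFunctional N n (bs u * a * bs v) = topFunctional N n (bs u * b * bs v)
  rw [show bs u = _ from basisFreeMonoid_apply u, show bs v = _ from basisFreeMonoid_apply v]
  generalize u.toList = u
  generalize v.toList = v
  cases h with
  | mul_transpose i j =>
    rw [Finset.mul_sum, Finset.sum_mul, map_sum]
    simp only [topFunctional_word_mul, ← inner_sum, ← map_sum]
    have hu : (u.map Prod.snd).length = (u.map Prod.fst).length := by simp
    rw [← cup_ketList, cupProj_cup, hu, ← inner_conj_symm, inner_cup, inner_conj_symm,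
      cap_ketList]
    split_ifs with hij
    · rw [mul_one, topFunctional_word]
    · simp
  | transpose_mul i j =>
    rw [Finset.mul_sum, Finset.sum_mul, map_sum]
    simp only [topFunctional_word_mul, ← sum_inner]
    have hu : (u.map Prod.fst).length = (u.map Prod.snd).length := by simp
    rw [← cup_ketList, hu, inner_cup, cap_cupProj, cap_ketList]
    split_ifs with hij
    · rw [mul_one, topFunctional_word]
    · simp

theorem powCoeff_eq_mk (n : ℕ) (x y : Fin n → Fin N) : powCoeff N n x y =
    RingQuot.mkAlgHom ℂ (OPlusRel N)
      ((List.ofFn fun s => (x s, y s)).map (FreeAlgebra.ι ℂ)).prod := by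
  rw [map_list_prod, List.map_map, List.map_ofFn]
  rfl

/-- The projections `cupProj` are given by a linear functional on `O_N^+`. -/
theorem exists_functional_powCoeff (N n : ℕ) : ∃ ψ : OPlus N →ₗ[ℂ] ℂ,
    ∀ (p : ℕ) (x y : Fin p → Fin N),
      ψ (powCoeff N p x y) = inner ℂ (ket x) (cupProj N n p (ket y)) := by
  obtain ⟨ψ, hψ⟩ := exists_functional_ringQuot (r := OPlusRel N) (topFunctional N n)
    fun a b h x y => topFunctional_rel n h x y
  refine ⟨ψ, fun p x y => ?_⟩
  rw [powCoeff_eq_mk, hψ, topFunctional_prod]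
  -- The length of the list equals `p` only propositionally, so it is replaced by a variable before
  -- rewriting.
  generalize hp : (List.ofFn fun s => (x s, y s)).length = q
  obtain rfl : p = q := by simpa using hp
  rw [← ketList_ofFn x, ← ketList_ofFn y, List.map_ofFn, List.map_ofFn]
  rfl

theorem inner_ket {n : ℕ} (x : Fin n → Fin N) (f : TensorPow N n) : inner ℂ (ket x) f = f x := by
  rw [ket, EuclideanSpace.inner_single_left]
  simp

/-- Applying the functional to `S u^{⊗ n} = u^{⊗ j} S` replaces the coefficients of `u` by the
matrix entries of `cupProj`. -/
theorem IsIntertwiner.comp_cupProj (n₀ : ℕ) {n j : ℕ} {S : TensorPow N n →ₗ[ℂ] TensorPow N j}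
    (hS : IsIntertwiner N S) (f : TensorPow N n) :
    S (cupProj N n₀ n f) = cupProj N n₀ j (S f) := by
  obtain ⟨ψ, hψ⟩ := exists_functional_powCoeff N n₀
  have key : ∀ z : Fin n → Fin N, S (cupProj N n₀ n (ket z)) = cupProj N n₀ j (S (ket z)) := by
    intro z
    ext x
    have h := congrArg ψ (hS x z)
    simp only [map_sum, map_smul, hψ, inner_ket] at h
    have h1 : S (cupProj N n₀ n (ket z)) x =
        ∑ y, S (ket y) x • cupProj N n₀ n (ket z) y := by
      conv_lhs => rw [sum_ket (cupProj N n₀ n (ket z)), map_sum]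
      simp [mul_comm]
    have h2 : cupProj N n₀ j (S (ket z)) x =
        ∑ w, S (ket z) w • cupProj N n₀ j (ket w) x := by
      conv_lhs => rw [sum_ket (S (ket z)), map_sum]
      simp
    rw [h1, h2, h]
  rw [sum_ket f]
  simp [key]

/-- With the cup span generated in degree `n`, its projection fixes `f` and is zero in degree `j <
n`, so commuting with it forces `S f = 0`. -/
theorem capKernel_le_irrepSpace (n : ℕ) : capKernel N n ≤ irrepSpace N n := by
  intro f hf j hj S hS
  have h := hS.comp_cupProj n f
  have h1 : cupProj N n n f = f :=
    Submodule.starProjection_eq_self_iff.2 (capKernel_le_cupSpan n hf)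
  have h2 : cupProj N n j (S f) = 0 := by
    have : cupProj N n j (S f) ∈ cupSpan N n j := Submodule.starProjection_apply_mem _ _
    rwa [cupSpan_eq_bot n j hj, Submodule.mem_bot] at this
  rw [← h1, h, h2]

end Intertwiners

/-! ### Recursive structure of `H_n` and its symmetry under reversal. -/

section Intertwiners

variable {N : ℕ}

theorem powCoeff_cons {n : ℕ} (c d : Fin N) (x y : Fin n → Fin N) :
    powCoeff N (n + 1) (Fin.cons c x) (Fin.cons d y) = gen N c d * powCoeff N n x y := by
  rw [powCoeff, List.ofFn_succ, List.prod_cons]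
  rfl

theorem sum_gen_mul_gen (i j : Fin N) :
    ∑ k, gen N k i * gen N k j = if i = j then 1 else 0 := by
  have h := RingQuot.mkAlgHom_rel ℂ (OPlusRel.transpose_mul (N := N) i j)
  rw [map_sum] at h
  simp only [map_mul] at h
  rw [apply_ite (RingQuot.mkAlgHom ℂ (OPlusRel N)), map_one, map_zero] at h
  exact h

theorem forall_cons {n : ℕ} {P : (Fin (n + 1) → Fin N) → Prop}
    (h : ∀ c x, P (Fin.cons c x)) (x : Fin (n + 1) → Fin N) : P x :=
  Fin.cons_self_tail x ▸ h (x 0) (Fin.tail x)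

/-- The tensor product of the identity on the first letter with `S`; both sides of the relation
acquire the same factor `u_{x₀ z₀}`. -/
theorem IsIntertwiner.shift {n j : ℕ} {S : TensorPow N n →ₗ[ℂ] TensorPow N j}
    (hS : IsIntertwiner N S) : IsIntertwiner N (∑ c, create c ∘ₗ S ∘ₗ annih c) := by
  have hval (c : Fin N) (y : Fin n → Fin N) :
      (∑ c, create c ∘ₗ S ∘ₗ annih c) (ket (Fin.cons c y : Fin (n + 1) → Fin N)) =
        create c (S (ket y)) := by
    rw [← create_ket]
    simp [annih_create, linearMap_ite]
  refine forall_cons fun x₀ x => forall_cons fun z₀ z => ?_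
  rw [sum_words, sum_words]
  simp only [hval, powCoeff_cons, create_apply, Fin.cons_zero, Fin.tail_cons]
  have h1 : ∀ c : Fin N, ∑ y : Fin n → Fin N, (if x₀ = c then S (ket y) x else 0) •
      (gen N c z₀ * powCoeff N n y z) =
      if x₀ = c then gen N x₀ z₀ * ∑ y, S (ket y) x • powCoeff N n y z else 0 := by
    intro c
    split_ifs with h
    · rw [h, Finset.mul_sum]
      simp only [mul_smul_comm]
    · simp
  have h2 : ∀ c : Fin N, ∑ w : Fin j → Fin N, (if c = z₀ then S (ket z) w else 0) •
      (gen N x₀ c * powCoeff N j x w) =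
      if c = z₀ then gen N x₀ z₀ * ∑ w, S (ket z) w • powCoeff N j x w else 0 := by
    intro c
    split_ifs with h
    · rw [h, Finset.mul_sum]
      simp only [mul_smul_comm]
    · simp
  simp only [h1, h2, hS x z]
  simp

theorem isIntertwiner_cap_zero (n : ℕ) : IsIntertwiner N (cap N n 0) := by
  have hval (c d : Fin N) (y : Fin n → Fin N) :
      cap N n 0 (ket (Fin.cons c (Fin.cons d y : Fin (n + 1) → Fin N) : Fin (n + 2) → Fin N)) =
        if c = d then ket y else 0 := by
    rw [← create_ket, ← create_ket]
    simp [cap_zero, annih_create, linearMap_ite]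
  intro x
  refine forall_cons fun z₀ => forall_cons fun z₁ z => ?_
  rw [sum_words]
  simp only [sum_words (n := n), hval, powCoeff_cons]
  have h1 : ∀ c d : Fin N, ∑ y : Fin n → Fin N, ((if c = d then ket y else 0 : TensorPow N n) x) •
      (gen N c z₀ * (gen N d z₁ * powCoeff N n y z)) =
      if c = d then gen N c z₀ * gen N c z₁ * powCoeff N n x z else 0 := by
    intro c d
    split_ifs with h
    · simp [ket_apply, h, mul_assoc]
    · simp
  have h2 : ∑ w : Fin n → Fin N, ((if z₀ = z₁ then ket z else 0 : TensorPow N n) w) •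
      powCoeff N n x w = if z₀ = z₁ then powCoeff N n x z else 0 := by
    split_ifs with h
    · simp [ket_apply]
    · simp
  simp only [h1, h2]
  simp only [Finset.sum_ite_eq, Finset.mem_univ, if_true, ← Finset.sum_mul, sum_gen_mul_gen]
  simp

/-! ### Recursive description of the irreducible subspaces -/

/-- For `S` into degree `j < n`, the map `id ⊗ S` goes from degree `n + 1` to degree `j + 1 < n +
1`. -/
theorem annih_mem_irrepSpace {n : ℕ} {f : TensorPow N (n + 1)} (hf : f ∈ irrepSpace N (n + 1))
    (d : Fin N) : annih d f ∈ irrepSpace N n := by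
  intro j hj S hS
  have h := congrArg (annih d) (hf (j + 1) (by omega) _ hS.shift)
  simpa [annih_create] using h

theorem cap_zero_of_mem_irrepSpace {n : ℕ} {f : TensorPow N (n + 2)}
    (hf : f ∈ irrepSpace N (n + 2)) : ∑ c, annih c (annih c f) = 0 := by
  rw [← cap_zero]
  exact hf n (by omega) _ (isIntertwiner_cap_zero n)

theorem cap_of_mem_irrepSpace : ∀ (n i : ℕ) (f : TensorPow N (n + 2)),
    f ∈ irrepSpace N (n + 2) → cap N n i f = 0
  | n, 0, f, hf => by rw [cap_zero, cap_zero_of_mem_irrepSpace hf]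
  | 0, i + 1, f, hf => by rw [cap_zero_succ, LinearMap.zero_apply]
  | n + 1, i + 1, f, hf => by
    rw [cap_succ]
    refine Finset.sum_eq_zero fun c _ => ?_
    rw [cap_of_mem_irrepSpace n i _ (annih_mem_irrepSpace hf c), map_zero]

theorem irrepSpace_zero : irrepSpace N 0 = ⊤ := top_le_iff.1 (capKernel_le_irrepSpace 0)

theorem irrepSpace_one : irrepSpace N 1 = ⊤ := top_le_iff.1 (capKernel_le_irrepSpace 1)

/-- The membership test for the Jones–Wenzl recursion: the cap at position 0 is the second
hypothesis, and all other caps act on the vectors `annih c f`. -/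
theorem mem_irrepSpace_of_annih : ∀ {n : ℕ} {f : TensorPow N (n + 2)},
    (∀ c, annih c f ∈ irrepSpace N (n + 1)) → ∑ c, annih c (annih c f) = 0 →
      f ∈ irrepSpace N (n + 2) := by
  intro n f h1 h2
  refine capKernel_le_irrepSpace _ (mem_capKernel.2 fun i => ?_)
  match n, i with
  | n, 0 => rw [cap_zero, h2]
  | 0, i + 1 => rw [cap_zero_succ, LinearMap.zero_apply]
  | n + 1, i + 1 =>
    rw [cap_succ]
    refine Finset.sum_eq_zero fun c _ => ?_
    rw [cap_of_mem_irrepSpace n i _ (h1 c), map_zero]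

/-! ### Invariance under reversal -/

theorem reverse_ofFn {α : Type*} {n : ℕ} (f : Fin n → α) :
    (List.ofFn f).reverse = List.ofFn fun i => f i.rev := by
  refine List.ext_getElem (by simp) fun i h₁ h₂ => ?_
  simp only [List.getElem_reverse, List.getElem_ofFn, List.length_ofFn]
  congr 1
  ext
  simp [Fin.val_rev]
  omega

/-- The anti-automorphism of the algebra of `O_N^+` which fixes the generators. -/
theorem exists_antiHom (N : ℕ) : ∃ τ : OPlus N →ₐ[ℂ] (OPlus N)ᵐᵒᵖ,
    ∀ i j, τ (gen N i j) = MulOpposite.op (gen N i j) := by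
  let φ : FreeAlgebra ℂ (Fin N × Fin N) →ₐ[ℂ] (OPlus N)ᵐᵒᵖ :=
    FreeAlgebra.lift ℂ fun ij => MulOpposite.op (gen N ij.1 ij.2)
  have hφ : ∀ ⦃a b⦄, OPlusRel N a b → φ a = φ b := by
    intro a b h
    apply MulOpposite.unop_injective
    cases h with
    | mul_transpose i j =>
      have h := RingQuot.mkAlgHom_rel ℂ (OPlusRel.mul_transpose (N := N) j i)
      rw [map_sum, apply_ite (RingQuot.mkAlgHom ℂ (OPlusRel N)), map_one, map_zero] at h
      simp only [map_mul] at h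
      rw [map_sum, apply_ite φ, map_one, map_zero, apply_ite MulOpposite.unop]
      simp only [φ, map_mul, FreeAlgebra.lift_ι_apply, Finset.unop_sum, MulOpposite.unop_mul,
        MulOpposite.unop_op, MulOpposite.unop_one, MulOpposite.unop_zero, eq_comm (a := i)]
      exact h
    | transpose_mul i j =>
      have h := sum_gen_mul_gen (N := N) j i
      rw [map_sum, apply_ite φ, map_one, map_zero, apply_ite MulOpposite.unop]
      simp only [φ, map_mul, FreeAlgebra.lift_ι_apply, Finset.unop_sum, MulOpposite.unop_mul,
        MulOpposite.unop_op, MulOpposite.unop_one, MulOpposite.unop_zero, eq_comm (a := i)]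
      exact h
  refine ⟨RingQuot.liftAlgHom ℂ ⟨φ, hφ⟩, fun i j => ?_⟩
  rw [gen, RingQuot.liftAlgHom_mkAlgHom_apply]
  simp [φ, gen]

/-- The anti-automorphism reverses products of generators, so it sends a coefficient of `u^{⊗ p}` to
the coefficient at the reversed words. Facts about the first letter thereby transfer to the last
one. -/
theorem IsIntertwiner.reverse {n j : ℕ} {S : TensorPow N n →ₗ[ℂ] TensorPow N j}
    (hS : IsIntertwiner N S) :
    IsIntertwiner N (TLChannel.reverse ∘ₗ S ∘ₗ TLChannel.reverse) := by
  obtain ⟨τ, hτ⟩ := exists_antiHom N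
  have hpow (p : ℕ) (x y : Fin p → Fin N) :
      (τ (powCoeff N p x y)).unop = powCoeff N p (x ∘ Fin.rev) (y ∘ Fin.rev) := by
    rw [powCoeff, map_list_prod, MulOpposite.unop_list_prod, List.map_ofFn, List.map_ofFn,
      reverse_ofFn]
    simp [powCoeff, hτ, Function.comp_def]
  intro x z
  have h := congrArg (fun a => (τ a).unop) (hS (x ∘ Fin.rev) (z ∘ Fin.rev))
  simp only [map_sum, map_smul, Finset.unop_sum, MulOpposite.unop_smul, hpow,
    comp_rev_rev] at h
  rw [← (revEquiv N n).sum_comp, ← (revEquiv N j).sum_comp]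
  simpa [reverse_ket, reverse_apply] using h

theorem reverse_mem_irrepSpace {n : ℕ} {f : TensorPow N n} (hf : f ∈ irrepSpace N n) :
    reverse f ∈ irrepSpace N n := by
  intro j hj S hS
  have h := congrArg reverse (hf j hj _ hS.reverse)
  simpa using h

end Intertwiners

/-! ### Quantum integers -/

/-- The quantum integer `[n]_q`, where `q + q⁻¹ = N`. -/
def qInt (N : ℕ) : ℕ → ℝ
  | 0 => 0
  | 1 => 1
  | n + 2 => N * qInt N (n + 1) - qInt N n

theorem qInt_add_two (N n : ℕ) : qInt N (n + 2) = N * qInt N (n + 1) - qInt N n := rfl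

theorem qInt_mono_pos {N : ℕ} (hN : 2 ≤ N) (n : ℕ) : qInt N n ≤ qInt N (n + 1) ∧ 0 < qInt N (n + 1) := by
  induction n with
  | zero => simp [qInt]
  | succ n ih =>
    have h : (2 : ℝ) ≤ N := by exact_mod_cast hN
    rw [qInt_add_two]
    constructor <;> nlinarith [ih.1, ih.2]

theorem qInt_pos {N : ℕ} (hN : 2 ≤ N) (n : ℕ) : 0 < qInt N (n + 1) := (qInt_mono_pos hN n).2

theorem qInt_nonneg {N : ℕ} (hN : 2 ≤ N) : ∀ n, 0 ≤ qInt N n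
  | 0 => le_rfl
  | n + 1 => (qInt_pos hN n).le

/-- The ratio `[n]_q / [n+1]_q`. -/
def qRatio (N n : ℕ) : ℝ := qInt N n / qInt N (n + 1)

theorem qRatio_zero (N : ℕ) : qRatio N 0 = 0 := by simp [qRatio, qInt]

theorem qRatio_nonneg {N : ℕ} (hN : 2 ≤ N) (n : ℕ) : 0 ≤ qRatio N n :=
  div_nonneg (qInt_nonneg hN _) (qInt_nonneg hN _)

/-- The recursion `[n+2] = N [n+1] - [n]` as a continued fraction, the form in which it fixes the
Jones–Wenzl coefficient. -/
theorem qRatio_mul_succ {N : ℕ} (hN : 2 ≤ N) (n : ℕ) :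
    qRatio N (n + 1) * (N - qRatio N n) = 1 := by
  have h1 := (qInt_pos hN n).ne'
  have h2 := (qInt_pos hN (n + 1)).ne'
  rw [qRatio, qRatio]
  field_simp
  rw [qInt_add_two]
  ring

/-- By monotonicity `[n+2] ≥ (N - 1) [n+1] ≥ (N/2) [n+1]`. -/
theorem qRatio_le {N : ℕ} (hN : 2 ≤ N) (n : ℕ) : qRatio N n ≤ 2 / N := by
  have h : (2 : ℝ) ≤ N := by exact_mod_cast hN
  cases n with
  | zero => rw [qRatio_zero]; positivity
  | succ n =>
    obtain ⟨h1, h2⟩ := qInt_mono_pos hN n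
    rw [qRatio, div_le_div_iff₀ (qInt_pos hN _) (by linarith), qInt_add_two]
    nlinarith

/-! ### Jones–Wenzl projections and the dimensions of the irreducibles. -/

section JonesWenzl

variable {N : ℕ}

/-! ### The projections onto the irreducible subspaces -/

theorem proj_mem {n : ℕ} (f : TensorPow N n) : proj N n f ∈ irrepSpace N n :=
  Submodule.starProjection_apply_mem _ _

theorem proj_eq_self {n : ℕ} {f : TensorPow N n} (hf : f ∈ irrepSpace N n) : proj N n f = f :=
  Submodule.starProjection_eq_self_iff.2 hf

theorem proj_proj {n : ℕ} (f : TensorPow N n) : proj N n (proj N n f) = proj N n f :=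
  proj_eq_self (proj_mem f)

theorem inner_proj {n : ℕ} (f g : TensorPow N n) :
    inner ℂ (proj N n f) g = inner ℂ f (proj N n g) :=
  Submodule.inner_starProjection_left_eq_right _ _ _

theorem proj_eq_of_mem {n : ℕ} {f g : TensorPow N n} (hg : g ∈ irrepSpace N n)
    (h : ∀ w ∈ irrepSpace N n, inner ℂ (f - g) w = 0) : proj N n f = g :=
  Submodule.eq_starProjection_of_mem_of_inner_eq_zero hg h

theorem inner_proj_of_mem {n : ℕ} (f : TensorPow N n) {w : TensorPow N n}
    (hw : w ∈ irrepSpace N n) : inner ℂ (proj N n f) w = inner ℂ f w := by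
  rw [inner_proj, proj_eq_self hw]

/-- The larger projection absorbs the smaller one, because removing a letter maps `H_{n+1}` into
`H_n`. -/
theorem proj_create_proj {n : ℕ} (c : Fin N) (f : TensorPow N n) :
    proj N (n + 1) (create c (proj N n f)) = proj N (n + 1) (create c f) := by
  refine ext_inner_right ℂ fun w => ?_
  rw [inner_proj, inner_create, inner_proj_of_mem _ (annih_mem_irrepSpace (proj_mem w) c),
    ← inner_create, ← inner_proj]

theorem proj_reverse {n : ℕ} (f : TensorPow N n) :
    proj N n (reverse f) = reverse (proj N n f) :=
  starProjection_comm inner_reverse (fun _ => reverse_mem_irrepSpace)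
    (fun _ => reverse_mem_irrepSpace) f

theorem proj_one (f : TensorPow N 1) : proj N 1 f = f :=
  proj_eq_self (irrepSpace_one ▸ Submodule.mem_top)

/-! ### The Jones–Wenzl recursion -/

theorem annih_proj_create_zero (c d : Fin N) (h : TensorPow N 0) :
    annih d (proj N 1 (create c h)) = if d = c then h else 0 := by
  rw [proj_one, annih_create]

/-- The Jones–Wenzl recursion at level `n`, given the partial trace one level below. -/
theorem annih_proj_create_of_trace (hN : 2 ≤ N) {n : ℕ}
    (htr : ∀ k ∈ irrepSpace N n, ∑ d, annih d (proj N (n + 1) (create d k)) =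
      ((N - qRatio N n : ℝ) : ℂ) • k)
    {h : TensorPow N (n + 1)} (hh : h ∈ irrepSpace N (n + 1)) (c d : Fin N) :
    annih d (proj N (n + 2) (create c h)) = (if d = c then h else 0) -
      (qRatio N (n + 1) : ℂ) • proj N (n + 1) (create d (annih c h)) := by
  set k := annih c h with hk
  have hkm : k ∈ irrepSpace N n := annih_mem_irrepSpace hh c
  -- The candidate for the projected vector. The correction is orthogonal to `H_{n+2}`, and its
  -- coefficient makes the contraction of the first two letters vanish.
  set g : TensorPow N (n + 2) := create c h -
    (qRatio N (n + 1) : ℂ) • ∑ e, create e (proj N (n + 1) (create e k)) with hg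
  have hag : ∀ d, annih d g = (if d = c then h else 0) -
      (qRatio N (n + 1) : ℂ) • proj N (n + 1) (create d k) := by
    intro d
    simp [hg, annih_create]
  have hgm : g ∈ irrepSpace N (n + 2) := by
    refine mem_irrepSpace_of_annih (fun d => ?_) ?_
    · rw [hag]
      refine Submodule.sub_mem _ ?_ (Submodule.smul_mem _ _ (proj_mem _))
      split_ifs
      · exact hh
      · exact zero_mem _
    -- The contraction is `k - qRatio (n+1) (N - qRatio n) k`, which is zero.
    · simp only [hag, map_sub, map_smul, Finset.sum_sub_distrib, linearMap_ite,
        ← Finset.smul_sum, htr k hkm, smul_smul, ← Complex.ofReal_mul, qRatio_mul_succ hN]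
      simp [hk]
  rw [← hag, proj_eq_of_mem hgm]
  intro w hw
  -- Pairing the correction with `w` in `H_{n+2}` contracts the first two letters of `w`, which
  -- gives zero.
  have h1 : create c h - g = (qRatio N (n + 1) : ℂ) • ∑ e, create e (proj N (n + 1) (create e k)) := by
    simp [hg]
  have h2 : ∀ e, inner ℂ (create e (proj N (n + 1) (create e k))) w =
      inner ℂ k (annih e (annih e w)) := by
    intro e
    rw [inner_create, inner_proj_of_mem _ (annih_mem_irrepSpace hw e), inner_create]
  rw [h1, inner_smul_left, sum_inner]
  simp only [h2]
  rw [← inner_sum, cap_zero_of_mem_irrepSpace hw, inner_zero_right, mul_zero]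

/-- The partial trace of `p_{n+1}` over one leg is a multiple of `p_n`. -/
theorem sum_annih_proj_create (hN : 2 ≤ N) : ∀ (n : ℕ), ∀ k ∈ irrepSpace N n,
    ∑ d, annih d (proj N (n + 1) (create d k)) = ((N - qRatio N n : ℝ) : ℂ) • k
  | 0, k, _ => by
    simp [annih_proj_create_zero, qRatio_zero, Nat.cast_smul_eq_nsmul]
  | n + 1, k, hk => by
    -- The recursion used here needs the partial trace only at level `n`, so the induction closes.
    simp only [annih_proj_create_of_trace hN (sum_annih_proj_create hN n) hk]
    rw [Finset.sum_sub_distrib, ← Finset.smul_sum, ← map_sum, sum_create_annih, proj_eq_self hk]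
    simp [sub_smul, Nat.cast_smul_eq_nsmul]

/-- The Jones–Wenzl recursion. -/
theorem annih_proj_create_succ (hN : 2 ≤ N) {n : ℕ} {h : TensorPow N (n + 1)}
    (hh : h ∈ irrepSpace N (n + 1)) (c d : Fin N) :
    annih d (proj N (n + 2) (create c h)) = (if d = c then h else 0) -
      (qRatio N (n + 1) : ℂ) • proj N (n + 1) (create d (annih c h)) :=
  annih_proj_create_of_trace hN (sum_annih_proj_create hN n) hh c d

theorem annihLast_proj_createLast {n : ℕ} (c d : Fin N) (h : TensorPow N n) :
    annihLast d (proj N (n + 1) (createLast c h)) =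
      reverse (annih d (proj N (n + 1) (create c (reverse h)))) := by
  rw [annihLast_apply, createLast_apply, proj_reverse, reverse_reverse]

theorem annihLast_proj_createLast_zero (c d : Fin N) (h : TensorPow N 0) :
    annihLast d (proj N 1 (createLast c h)) = if d = c then h else 0 := by
  rw [annihLast_proj_createLast, annih_proj_create_zero, linearMap_ite, reverse_reverse]

/-- The Jones–Wenzl recursion with respect to the last letter. -/
theorem annihLast_proj_createLast_succ (hN : 2 ≤ N) {n : ℕ} {h : TensorPow N (n + 1)}
    (hh : h ∈ irrepSpace N (n + 1)) (c d : Fin N) :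
    annihLast d (proj N (n + 2) (createLast c h)) = (if d = c then h else 0) -
      (qRatio N (n + 1) : ℂ) • proj N (n + 1) (createLast d (annihLast c h)) := by
  rw [annihLast_proj_createLast, annih_proj_create_succ hN (reverse_mem_irrepSpace hh), map_sub,
    linearMap_ite, reverse_reverse, map_smul, createLast_apply, annihLast_apply, reverse_reverse,
    proj_reverse]

theorem sum_createLast_annihLast {n : ℕ} (f : TensorPow N (n + 1)) :
    ∑ c, createLast c (annihLast c f) = f := by
  simp only [createLast_apply, annihLast_apply, reverse_reverse, ← map_sum, sum_create_annih]

theorem annihLast_mem_irrepSpace {n : ℕ} {f : TensorPow N (n + 1)}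
    (hf : f ∈ irrepSpace N (n + 1)) (d : Fin N) : annihLast d f ∈ irrepSpace N n :=
  reverse_mem_irrepSpace (annih_mem_irrepSpace (reverse_mem_irrepSpace hf) d)

theorem proj_createLast_proj {n : ℕ} (c : Fin N) (f : TensorPow N n) :
    proj N (n + 1) (createLast c (proj N n f)) = proj N (n + 1) (createLast c f) := by
  rw [createLast_apply, createLast_apply, proj_reverse, proj_reverse, ← proj_reverse f,
    proj_create_proj]

/-! ### Dimensions -/

theorem trace_proj (n : ℕ) : LinearMap.trace ℂ _ (proj N n) = (qSucc N n : ℂ) := by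
  have h : LinearMap.IsProj (irrepSpace N n) (proj N n) :=
    ⟨proj_mem, fun f hf => proj_eq_self hf⟩
  rw [h.trace, qSucc]
  simp

theorem trace_eq_sum_ket {n : ℕ} (T : TensorPow N n →ₗ[ℂ] TensorPow N n) :
    LinearMap.trace ℂ _ T = ∑ x, inner ℂ (ket x) (T (ket x)) := by
  rw [LinearMap.trace_eq_sum_inner T (EuclideanSpace.basisFun _ ℂ)]
  simp [ket]

/-- The trace of `p_{n+1}` is taken in two stages; tracing out the first letter leaves `N - qRatio N
n` times `p_n`. -/
theorem qSucc_succ (hN : 2 ≤ N) (n : ℕ) : qSucc N (n + 1) = (N - qRatio N n) * qSucc N n := by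
  have h : LinearMap.trace ℂ _ (proj N (n + 1)) =
      LinearMap.trace ℂ _ (((N - qRatio N n : ℝ) : ℂ) • proj N n) := by
    rw [trace_eq_sum_ket, trace_eq_sum_ket, sum_words, Finset.sum_comm]
    refine Finset.sum_congr rfl fun x _ => ?_
    simp only [← create_ket, inner_create]
    rw [← inner_sum]
    congr 1
    rw [LinearMap.smul_apply, ← sum_annih_proj_create hN n _ (proj_mem _)]
    simp only [proj_create_proj]
  rw [map_smul, trace_proj, trace_proj, smul_eq_mul, ← Complex.ofReal_mul] at h
  exact Complex.ofReal_injective h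

theorem qSucc_eq_qInt (hN : 2 ≤ N) (n : ℕ) : qSucc N n = qInt N (n + 1) := by
  induction n with
  | zero =>
    rw [qSucc, irrepSpace_zero, finrank_top, finrank_euclideanSpace]
    simp [qInt]
  | succ n ih =>
    rw [qSucc_succ hN, ih, qRatio, qInt_add_two]
    have := (qInt_pos hN n).ne'
    field_simp

end JonesWenzl

/-! ### Concatenation, and `H_{a+b}` inside `H_a ⊗ H_b`. -/

section Concat

variable {N : ℕ}

/-! ### Concatenation of words -/

theorem concat_ket {a b n : ℕ} (h : a + b = n) (x : Fin a → Fin N) (y : Fin b → Fin N) :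
    concat N h (ket x ⊗ₜ ket y) = ket (Fin.append x y ∘ Fin.cast h.symm) := by
  have h1 : (ket x ⊗ₜ[ℂ] ket y : TensorPow N a ⊗[ℂ] TensorPow N b) =
      (EuclideanSpace.basisFun (Fin a → Fin N) ℂ).tensorProduct
        (EuclideanSpace.basisFun (Fin b → Fin N) ℂ) (x, y) := by
    simp [ket]
  rw [h1, concat, OrthonormalBasis.equiv_apply_basis, EuclideanSpace.basisFun_apply, ket]
  rfl

theorem ofFn_comp_cast {α : Type*} {m n : ℕ} (h : n = m) (x : Fin m → α) :
    List.ofFn (x ∘ Fin.cast h) = List.ofFn x := by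
  subst h
  rfl

theorem tmul_ext {a b n : ℕ} {S T : TensorPow N a →ₗ[ℂ] TensorPow N b →ₗ[ℂ] TensorPow N n}
    (h : ∀ x y, S (ket x) (ket y) = T (ket x) (ket y)) : S = T :=
  (EuclideanSpace.basisFun _ ℂ).toBasis.ext fun x =>
    (EuclideanSpace.basisFun _ ℂ).toBasis.ext fun y => by simpa [ket] using h x y

/-- Concatenation as a bilinear map. -/
def concatBilin (N : ℕ) {a b n : ℕ} (h : a + b = n) :
    TensorPow N a →ₗ[ℂ] TensorPow N b →ₗ[ℂ] TensorPow N n :=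
  (TensorProduct.mk ℂ _ _).compr₂ (concat N h).toLinearEquiv.toLinearMap

theorem concatBilin_ket {a b n : ℕ} (h : a + b = n) (x : Fin a → Fin N) (y : Fin b → Fin N) :
    concatBilin N h (ket x) (ket y) = ket (Fin.append x y ∘ Fin.cast h.symm) := concat_ket h x y

theorem ofFn_append_cast {a b n : ℕ} (h : a + b = n) (x : Fin a → Fin N) (y : Fin b → Fin N) :
    List.ofFn (Fin.append x y ∘ Fin.cast h.symm) = List.ofFn x ++ List.ofFn y := by
  rw [ofFn_comp_cast, List.ofFn_fin_append]

theorem ofFn_cons {n : ℕ} (c : Fin N) (x : Fin n → Fin N) :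
    List.ofFn (Fin.cons c x : Fin (n + 1) → Fin N) = c :: List.ofFn x := by
  simp [List.ofFn_succ]

theorem ofFn_snoc {n : ℕ} (c : Fin N) (x : Fin n → Fin N) :
    List.ofFn (Fin.snoc x c : Fin (n + 1) → Fin N) = List.ofFn x ++ [c] := by
  rw [List.ofFn_succ']
  simp [List.concat_eq_append]

theorem concat_create {a b n : ℕ} (h : a + 1 + b = n + 1) (h' : a + b = n) (c : Fin N)
    (f : TensorPow N a) (g : TensorPow N b) :
    concat N h (create c f ⊗ₜ g) = create c (concat N h' (f ⊗ₜ g)) := by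
  have : concatBilin N h ∘ₗ create c = (concatBilin N h').compr₂ (create c) := by
    refine tmul_ext fun x y => ?_
    simp only [LinearMap.comp_apply, LinearMap.compr₂_apply, create_ket, concatBilin_ket]
    congr 1
    apply List.ofFn_injective
    erw [ofFn_append_cast h, ofFn_cons, ofFn_cons, ofFn_append_cast h', List.cons_append]
  exact LinearMap.congr_fun (LinearMap.congr_fun this f) g

theorem concat_createLast {a b n : ℕ} (h : a + (b + 1) = n + 1) (h' : a + b = n) (c : Fin N)
    (f : TensorPow N a) (g : TensorPow N b) :
    concat N h (f ⊗ₜ createLast c g) = createLast c (concat N h' (f ⊗ₜ g)) := by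
  have : (concatBilin N h).compl₂ (createLast c) = (concatBilin N h').compr₂ (createLast c) := by
    refine tmul_ext fun x y => ?_
    simp only [LinearMap.compl₂_apply, LinearMap.compr₂_apply, createLast_ket, concatBilin_ket]
    congr 1
    apply List.ofFn_injective
    erw [ofFn_append_cast h, ofFn_snoc, ofFn_snoc, ofFn_append_cast h', List.append_assoc]
  exact LinearMap.congr_fun (LinearMap.congr_fun this f) g

theorem create_createLast {n : ℕ} (c d : Fin N) (f : TensorPow N n) :
    createLast d (create c f) = create c (createLast d f) := by
  have : createLast d ∘ₗ create c = create c ∘ₗ createLast (n := n) d :=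
    (EuclideanSpace.basisFun _ ℂ).toBasis.ext fun x => by
      have : createLast d (create c (ket x)) = create c (createLast d (ket x)) := by
        simp only [create_ket, createLast_ket]
        congr 1
        apply List.ofFn_injective
        simp only [ofFn_cons, ofFn_snoc, List.cons_append]
      simpa [ket] using this
  exact LinearMap.congr_fun this f

theorem concat_zero_left {b : ℕ} (h : 0 + b = b) (x : Fin 0 → Fin N) (g : TensorPow N b) :
    concat N h (ket x ⊗ₜ g) = g := by
  have : concatBilin N h (ket x) = LinearMap.id :=
    (EuclideanSpace.basisFun _ ℂ).toBasis.ext fun y => by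
      have : concatBilin N h (ket x) (ket y) = ket y := by
        rw [concatBilin_ket]
        congr 1
        apply List.ofFn_injective
        simp [ofFn_append_cast]
      simpa [ket] using this
  exact LinearMap.congr_fun this g

theorem concat_zero_right {a : ℕ} (h : a + 0 = a) (y : Fin 0 → Fin N) (f : TensorPow N a) :
    concat N h (f ⊗ₜ ket y) = f := by
  have : (concatBilin N h).flip (ket y) = LinearMap.id :=
    (EuclideanSpace.basisFun _ ℂ).toBasis.ext fun x => by
      have : concatBilin N h (ket x) (ket y) = ket x := by
        rw [concatBilin_ket]
        congr 1
        apply List.ofFn_injective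
        simp
      simpa [ket] using this
  exact LinearMap.congr_fun this f

theorem eq_smul_ket (f : TensorPow N 0) : f = f Fin.elim0 • ket Fin.elim0 := by
  conv_lhs => rw [sum_ket f]
  rw [Fintype.sum_unique, Subsingleton.elim default Fin.elim0]

/-! ### Splitting the vectors of an irreducible subspace -/

/-- The letters of `f` are peeled off one at a time; each removal sends `ξ` to the next smaller
irreducible space, until only the projected factor remains. -/
theorem inner_concat_proj_right : ∀ {a b n : ℕ} (h : a + b = n) (f : TensorPow N a)
    (g : TensorPow N b), ∀ ξ ∈ irrepSpace N n,
      inner ℂ (concat N h (f ⊗ₜ proj N b g)) ξ = inner ℂ (concat N h (f ⊗ₜ g)) ξ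
  | 0, b, n, h, f, g, ξ, hξ => by
    obtain rfl : b = n := by omega
    rw [eq_smul_ket f, ← TensorProduct.smul_tmul', ← TensorProduct.smul_tmul', map_smul, map_smul,
      concat_zero_left, concat_zero_left, inner_smul_left, inner_smul_left,
      inner_proj_of_mem _ hξ]
  | a + 1, b, n, h, f, g, ξ, hξ => by
    obtain rfl : n = a + b + 1 := by omega
    rw [← sum_create_annih f]
    simp only [TensorProduct.sum_tmul, map_sum, sum_inner, concat_create h rfl, inner_create]
    exact Finset.sum_congr rfl fun c _ =>
      inner_concat_proj_right rfl _ _ _ (annih_mem_irrepSpace hξ c)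

theorem inner_concat_proj_left : ∀ {a b n : ℕ} (h : a + b = n) (f : TensorPow N a)
    (g : TensorPow N b), ∀ ξ ∈ irrepSpace N n,
      inner ℂ (concat N h (proj N a f ⊗ₜ g)) ξ = inner ℂ (concat N h (f ⊗ₜ g)) ξ
  | a, 0, n, h, f, g, ξ, hξ => by
    obtain rfl : a = n := by omega
    rw [eq_smul_ket g, TensorProduct.tmul_smul, TensorProduct.tmul_smul, map_smul, map_smul,
      concat_zero_right, concat_zero_right, inner_smul_left, inner_smul_left,
      inner_proj_of_mem _ hξ]
  | a, b + 1, n, h, f, g, ξ, hξ => by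
    obtain rfl : n = a + b + 1 := by omega
    rw [← sum_createLast_annihLast g]
    simp only [TensorProduct.tmul_sum, map_sum, sum_inner, concat_createLast h rfl,
      inner_createLast]
    exact Finset.sum_congr rfl fun c _ =>
      inner_concat_proj_left rfl _ _ _ (annihLast_mem_irrepSpace hξ c)

/-- Peeling off the letters of `f` brings the cup to the front, where it is paired with the
vanishing contraction of the first two letters. -/
theorem sum_inner_concat_cup : ∀ {a b n : ℕ} (h : a + 1 + (b + 1) = n) (f : TensorPow N a)
    (g : TensorPow N b), ∀ ξ ∈ irrepSpace N n,
      ∑ c, inner ℂ (concat N h (createLast c f ⊗ₜ create c g)) ξ = 0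
  | 0, b, n, h, f, g, ξ, hξ => by
    obtain rfl : n = b + 1 + 1 := by omega
    have h1 (c : Fin N) : createLast c (ket (Fin.elim0 : Fin 0 → Fin N)) = create c (ket Fin.elim0) := by
      rw [create_ket, createLast_ket]
      congr 1
      apply List.ofFn_injective
      simp only [ofFn_cons, ofFn_snoc, List.ofFn_zero, List.nil_append]
    rw [eq_smul_ket f]
    simp only [map_smul, h1, ← TensorProduct.smul_tmul', inner_smul_left, ← Finset.mul_sum,
      concat_create h (by omega : 0 + (b + 1) = b + 1), concat_zero_left, inner_create]
    rw [← inner_sum, cap_zero_of_mem_irrepSpace hξ, inner_zero_right, mul_zero]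
  | a + 1, b, n, h, f, g, ξ, hξ => by
    obtain rfl : n = (a + 1 + (b + 1)) + 1 := by omega
    rw [← sum_create_annih f]
    simp only [TensorProduct.sum_tmul, map_sum, sum_inner, create_createLast, concat_create h rfl,
      inner_create]
    rw [Finset.sum_comm]
    exact Finset.sum_eq_zero fun e _ =>
      sum_inner_concat_cup rfl _ _ _ (annih_mem_irrepSpace hξ e)

end Concat

/-! ### The scalar produced by projected nested cups. -/

section Cups

variable {N : ℕ}

theorem inner_map_of_adjoint {A B C D : Type*}
    [NormedAddCommGroup A] [InnerProductSpace ℂ A] [NormedAddCommGroup B] [InnerProductSpace ℂ B]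
    [NormedAddCommGroup C] [InnerProductSpace ℂ C] [NormedAddCommGroup D] [InnerProductSpace ℂ D]
    {S : A →ₗ[ℂ] C} {S' : C →ₗ[ℂ] A} {T : B →ₗ[ℂ] D} {T' : D →ₗ[ℂ] B}
    (hS : ∀ x y, inner ℂ (S x) y = inner ℂ x (S' y))
    (hT : ∀ x y, inner ℂ (T x) y = inner ℂ x (T' y)) (x : A ⊗[ℂ] B) (y : C ⊗[ℂ] D) :
    inner ℂ (TensorProduct.map S T x) y = inner ℂ x (TensorProduct.map S' T' y) := by
  induction x with
  | zero => simp
  | add x x' hx hx' => rw [map_add, inner_add_left, inner_add_left, hx, hx']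
  | tmul a b =>
    induction y with
    | zero => simp
    | add y y' hy hy' => rw [map_add, inner_add_right, inner_add_right, hy, hy']
    | tmul c d => simp [TensorProduct.inner_tmul, hS, hT]

/-- The projection `p_n ⊗ p_{n'}`. -/
def projTensor (N n n' : ℕ) :
    TensorPow N n ⊗[ℂ] TensorPow N n' →ₗ[ℂ] TensorPow N n ⊗[ℂ] TensorPow N n' :=
  TensorProduct.map (proj N n) (proj N n')

theorem projTensor_tmul {n n' : ℕ} (f : TensorPow N n) (g : TensorPow N n') :
    projTensor N n n' (f ⊗ₜ g) = proj N n f ⊗ₜ proj N n' g := rfl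

theorem projTensor_projTensor {n n' : ℕ} (s : TensorPow N n ⊗[ℂ] TensorPow N n') :
    projTensor N n n' (projTensor N n n' s) = projTensor N n n' s := by
  have : projTensor N n n' ∘ₗ projTensor N n n' = projTensor N n n' :=
    TensorProduct.ext' fun f g => by simp [projTensor_tmul, proj_proj]
  exact LinearMap.congr_fun this s

theorem inner_projTensor {n n' : ℕ} (s t : TensorPow N n ⊗[ℂ] TensorPow N n') :
    inner ℂ (projTensor N n n' s) t = inner ℂ s (projTensor N n n' t) :=
  inner_map_of_adjoint inner_proj inner_proj s t

/-- Insertion of a cup between the two tensor factors. -/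
def cupMid (N n n' : ℕ) :
    TensorPow N n ⊗[ℂ] TensorPow N n' →ₗ[ℂ] TensorPow N (n + 1) ⊗[ℂ] TensorPow N (n' + 1) :=
  ∑ c, TensorProduct.map (createLast c) (create c)

/-- Contraction of the last letter of the first factor with the first one of the second factor. -/
def capMid (N n n' : ℕ) :
    TensorPow N (n + 1) ⊗[ℂ] TensorPow N (n' + 1) →ₗ[ℂ] TensorPow N n ⊗[ℂ] TensorPow N n' :=
  ∑ c, TensorProduct.map (annihLast c) (annih c)

theorem cupMid_tmul {n n' : ℕ} (f : TensorPow N n) (g : TensorPow N n') :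
    cupMid N n n' (f ⊗ₜ g) = ∑ c, createLast c f ⊗ₜ create c g := by
  simp [cupMid]

theorem capMid_tmul {n n' : ℕ} (f : TensorPow N (n + 1)) (g : TensorPow N (n' + 1)) :
    capMid N n n' (f ⊗ₜ g) = ∑ c, annihLast c f ⊗ₜ annih c g := by
  simp [capMid]

theorem inner_cupMid {n n' : ℕ} (s : TensorPow N n ⊗[ℂ] TensorPow N n')
    (t : TensorPow N (n + 1) ⊗[ℂ] TensorPow N (n' + 1)) :
    inner ℂ (cupMid N n n' s) t = inner ℂ s (capMid N n n' t) := by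
  simp only [cupMid, capMid, LinearMap.sum_apply, sum_inner, inner_sum]
  exact Finset.sum_congr rfl fun c _ =>
    inner_map_of_adjoint (inner_createLast c) (inner_create c) s t

theorem annihLast_createLast {n : ℕ} (d c : Fin N) (f : TensorPow N n) :
    annihLast d (createLast c f) = if d = c then f else 0 := by
  rw [annihLast_apply, createLast_apply, reverse_reverse, annih_create, linearMap_ite,
    reverse_reverse]

/-- A sum over a pair of letters which occurs in the contraction of a projected cup. -/
theorem sum_ite_sub_tmul {F G : Type*} [AddCommGroup F] [Module ℂ F] [AddCommGroup G] [Module ℂ G]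
    (f : F) (g : G) (A : Fin N → Fin N → F) (B : Fin N → Fin N → G) (a b : ℂ)
    (hA : a • ∑ c, A c c = a • f) (hB : b • ∑ c, B c c = b • g) :
    ∑ c, ∑ d, ((if d = c then f else 0) - a • A d c) ⊗ₜ[ℂ] ((if d = c then g else 0) - b • B d c) =
      (N - a - b) • f ⊗ₜ[ℂ] g + (a * b) • ∑ c, ∑ d, A d c ⊗ₜ[ℂ] B d c := by
  have h1 : ∑ c, A c c ⊗ₜ[ℂ] (a • g) = a • f ⊗ₜ[ℂ] g := by
    rw [← TensorProduct.sum_tmul, ← TensorProduct.smul_tmul, hA, TensorProduct.smul_tmul']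
  have h2 : ∑ c, (b • f) ⊗ₜ[ℂ] B c c = b • f ⊗ₜ[ℂ] g := by
    rw [← TensorProduct.tmul_sum, TensorProduct.smul_tmul, hB, TensorProduct.tmul_smul]
  have h3 : ∀ c d, ((if d = c then f else 0) - a • A d c) ⊗ₜ[ℂ]
      ((if d = c then g else 0) - b • B d c) =
      (if d = c then f ⊗ₜ[ℂ] g - A c c ⊗ₜ[ℂ] (a • g) - (b • f) ⊗ₜ[ℂ] B c c else 0) +
        (a * b) • A d c ⊗ₜ[ℂ] B d c := by
    intro c d
    split_ifs with h
    · subst h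
      simp only [TensorProduct.sub_tmul, TensorProduct.tmul_sub, TensorProduct.tmul_smul,
        ← TensorProduct.smul_tmul', smul_sub, smul_smul, mul_comm b a]
      abel
    · rw [zero_sub, zero_sub, TensorProduct.neg_tmul, TensorProduct.tmul_neg, neg_neg,
        TensorProduct.tmul_smul, ← TensorProduct.smul_tmul', smul_smul, mul_comm b a, zero_add]
  simp only [h3, Finset.sum_add_distrib, Finset.sum_ite_eq', Finset.mem_univ, if_true,
    Finset.sum_sub_distrib, h1, h2, ← Finset.smul_sum]
  simp [sub_smul, Nat.cast_smul_eq_nsmul]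

theorem projTensor_cupMid_projTensor {n n' : ℕ} (s : TensorPow N n ⊗[ℂ] TensorPow N n') :
    projTensor N _ _ (cupMid N n n' (projTensor N n n' s)) =
      projTensor N _ _ (cupMid N n n' s) := by
  have : projTensor N _ _ ∘ₗ cupMid N n n' ∘ₗ projTensor N n n' =
      projTensor N _ _ ∘ₗ cupMid N n n' :=
    TensorProduct.ext' fun f g => by
      simp [projTensor_tmul, cupMid_tmul, proj_create_proj, proj_createLast_proj]
  exact LinearMap.congr_fun this s

theorem capMid_projTensor_cupMid_tmul {n n' : ℕ} (f : TensorPow N n) (g : TensorPow N n') :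
    capMid N n n' (projTensor N _ _ (cupMid N n n' (f ⊗ₜ g))) =
      ∑ c, ∑ d, annihLast d (proj N _ (createLast c f)) ⊗ₜ[ℂ]
        annih d (proj N _ (create c g)) := by
  simp [cupMid_tmul, projTensor_tmul, capMid_tmul]

/-- A common form of the recursion for `n = 0` and `n > 0`. The sum of `B c c` is controlled only up
to the factor `qRatio N n`, which vanishes at `n = 0`, where `B = 0`. -/
theorem exists_annih_proj_create (hN : 2 ≤ N) : ∀ {n : ℕ} {g : TensorPow N n},
    g ∈ irrepSpace N n → ∃ B : Fin N → Fin N → TensorPow N n,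
      (qRatio N n : ℂ) • ∑ c, B c c = (qRatio N n : ℂ) • g ∧ ∀ c d,
        annih d (proj N (n + 1) (create c g)) =
          (if d = c then g else 0) - (qRatio N n : ℂ) • B d c
  | 0, g, _ => ⟨fun _ _ => 0, by simp [qRatio_zero], fun c d => by
      simp [annih_proj_create_zero]⟩
  | n + 1, g, hg => ⟨fun d c => proj N (n + 1) (create d (annih c g)), by
      rw [← map_sum, sum_create_annih, proj_eq_self hg], fun c d =>
      annih_proj_create_succ hN hg c d⟩

theorem exists_annihLast_proj_createLast (hN : 2 ≤ N) : ∀ {n : ℕ} {g : TensorPow N n},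
    g ∈ irrepSpace N n → ∃ B : Fin N → Fin N → TensorPow N n,
      (qRatio N n : ℂ) • ∑ c, B c c = (qRatio N n : ℂ) • g ∧ ∀ c d,
        annihLast d (proj N (n + 1) (createLast c g)) =
          (if d = c then g else 0) - (qRatio N n : ℂ) • B d c
  | 0, g, _ => ⟨fun _ _ => 0, by simp [qRatio_zero], fun c d => by
      simp [annihLast_proj_createLast_zero]⟩
  | n + 1, g, hg => ⟨fun d c => proj N (n + 1) (createLast d (annihLast c g)), by
      rw [← map_sum, sum_createLast_annihLast, proj_eq_self hg], fun c d =>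
      annihLast_proj_createLast_succ hN hg c d⟩

/-- If one side has no letters, one of the ratios is zero and the term quadratic in the ratios
disappears. -/
theorem capMid_projTensor_cupMid_of_zero (hN : 2 ≤ N) {n n' : ℕ} (h : n = 0 ∨ n' = 0)
    {s : TensorPow N n ⊗[ℂ] TensorPow N n'} (hs : projTensor N n n' s = s) :
    capMid N n n' (projTensor N _ _ (cupMid N n n' s)) =
      ((N - qRatio N n - qRatio N n' : ℝ) : ℂ) • s := by
  have key : capMid N n n' ∘ₗ projTensor N _ _ ∘ₗ cupMid N n n' ∘ₗ projTensor N n n' =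
      ((N - qRatio N n - qRatio N n' : ℝ) : ℂ) • projTensor N n n' := by
    refine TensorProduct.ext' fun f g => ?_
    obtain ⟨A, hA, hA'⟩ := exists_annihLast_proj_createLast hN (proj_mem f)
    obtain ⟨B, hB, hB'⟩ := exists_annih_proj_create hN (proj_mem g)
    have h0 : (qRatio N n : ℂ) * qRatio N n' = 0 := by
      rcases h with rfl | rfl <;> simp [qRatio_zero]
    simp only [LinearMap.comp_apply, projTensor_tmul f g, capMid_projTensor_cupMid_tmul,
      hA', hB', LinearMap.smul_apply]
    rw [sum_ite_sub_tmul _ _ A B _ _ hA hB, h0, zero_smul, add_zero]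
    push_cast
    rfl
  simpa [hs] using LinearMap.congr_fun key s

/-- The Jones–Wenzl recursion on both sides gives four terms: the closed loop contributes `N`, each
mixed term subtracts one ratio, and the last term reinserts a cup after a contraction. -/
theorem capMid_projTensor_cupMid (hN : 2 ≤ N) {n n' : ℕ}
    {s : TensorPow N (n + 1) ⊗[ℂ] TensorPow N (n' + 1)} (hs : projTensor N _ _ s = s) :
    capMid N _ _ (projTensor N _ _ (cupMid N _ _ s)) =
      ((N - qRatio N (n + 1) - qRatio N (n' + 1) : ℝ) : ℂ) • s +
        ((qRatio N (n + 1) * qRatio N (n' + 1) : ℝ) : ℂ) •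
          projTensor N _ _ (cupMid N _ _ (capMid N _ _ s)) := by
  have key : capMid N _ _ ∘ₗ projTensor N _ _ ∘ₗ cupMid N _ _ ∘ₗ projTensor N (n + 1) (n' + 1) =
      ((N - qRatio N (n + 1) - qRatio N (n' + 1) : ℝ) : ℂ) • projTensor N (n + 1) (n' + 1) +
        ((qRatio N (n + 1) * qRatio N (n' + 1) : ℝ) : ℂ) •
          (projTensor N _ _ ∘ₗ cupMid N _ _ ∘ₗ capMid N _ _ ∘ₗ projTensor N _ _) := by
    refine TensorProduct.ext' fun f g => ?_
    simp only [LinearMap.comp_apply, projTensor_tmul f g, capMid_projTensor_cupMid_tmul,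
      annih_proj_create_succ hN (proj_mem g), annihLast_proj_createLast_succ hN (proj_mem f),
      LinearMap.smul_apply, LinearMap.add_apply]
    rw [sum_ite_sub_tmul]
    · simp [capMid_tmul, cupMid_tmul, projTensor_tmul]
    · rw [← map_sum, sum_createLast_annihLast, proj_proj]
    · rw [← map_sum, sum_create_annih, proj_proj]
  simpa [hs] using LinearMap.congr_fun key s

theorem capMid_projTensor_cupMid_of_capMid (hN : 2 ≤ N) {n n' : ℕ}
    {s : TensorPow N (n + 1) ⊗[ℂ] TensorPow N (n' + 1)} {t : TensorPow N n ⊗[ℂ] TensorPow N n'}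
    {x : ℝ} (hs : projTensor N _ _ s = s) (ht : projTensor N _ _ (cupMid N _ _ t) = s)
    (h : capMid N _ _ s = (x : ℂ) • t) :
    capMid N _ _ (projTensor N _ _ (cupMid N _ _ s)) =
      ((N - qRatio N (n + 1) - qRatio N (n' + 1) +
        qRatio N (n + 1) * qRatio N (n' + 1) * x : ℝ) : ℂ) • s := by
  rw [capMid_projTensor_cupMid hN hs, h, map_smul, map_smul, ht, smul_smul, ← add_smul]
  push_cast
  rfl

/-- Insertion of `r` nested cups between the two tensor factors. -/
def nestCups (N a b : ℕ) :
    (r : ℕ) → TensorPow N a ⊗[ℂ] TensorPow N b →ₗ[ℂ] TensorPow N (a + r) ⊗[ℂ] TensorPow N (b + r)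
  | 0 => LinearMap.id
  | r + 1 => cupMid N (a + r) (b + r) ∘ₗ nestCups N a b r

theorem capMid_cupMid {n n' : ℕ} (s : TensorPow N n ⊗[ℂ] TensorPow N n') :
    capMid N n n' (cupMid N n n' s) = (N : ℂ) • s := by
  have : capMid N n n' ∘ₗ cupMid N n n' = (N : ℂ) • LinearMap.id := by
    refine TensorProduct.ext' fun f g => ?_
    have (c d : Fin N) : (if d = c then f else 0) ⊗ₜ[ℂ] (if d = c then g else 0) =
        if d = c then f ⊗ₜ[ℂ] g else 0 := by
      split_ifs <;> simp
    simp [cupMid_tmul, capMid_tmul, annihLast_createLast, annih_create, this,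
      Nat.cast_smul_eq_nsmul]
  exact LinearMap.congr_fun this s

theorem inner_nestCups {a b : ℕ} (r : ℕ) (s t : TensorPow N a ⊗[ℂ] TensorPow N b) :
    inner ℂ (nestCups N a b r s) (nestCups N a b r t) = (N : ℂ) ^ r * inner ℂ s t := by
  induction r with
  | zero => simp [nestCups]
  | succ r ih =>
    have h1 := inner_cupMid (nestCups N a b r s) (cupMid N _ _ (nestCups N a b r t))
    have h2 := inner_smul_right (𝕜 := ℂ) (nestCups N a b r s) (nestCups N a b r t) (N : ℂ)
    rw [capMid_cupMid] at h1
    refine h1.trans (h2.trans ?_)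
    rw [ih, pow_succ]
    ring

/-- The scalar `[r+1]_q [a+b+r+2]_q / ([a+r+1]_q [b+r+1]_q)`. -/
def cupRatio (N a b r : ℕ) : ℝ :=
  qInt N (r + 1) * qInt N (a + b + r + 2) / (qInt N (a + r + 1) * qInt N (b + r + 1))

/-- The addition formula behind the closed form of `cupRatio`; induction on `x` moves one unit to
`y`. -/
theorem qInt_add (N : ℕ) (y x : ℕ) :
    qInt N (x + y + 1) = qInt N (x + 1) * qInt N (y + 1) - qInt N x * qInt N y := by
  induction x generalizing y with
  | zero => simp [qInt]
  | succ x ih =>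
    have := ih (y + 1)
    rw [show x + 1 + y + 1 = x + (y + 1) + 1 by ring, this, qInt_add_two, qInt_add_two]
    ring

theorem sub_qRatio (hN : 2 ≤ N) (a b : ℕ) :
    N - qRatio N a - qRatio N b = qInt N (a + b + 2) / (qInt N (a + 1) * qInt N (b + 1)) := by
  have h1 := (qInt_pos hN a).ne'
  have h2 := (qInt_pos hN b).ne'
  rw [show a + b + 2 = a + 1 + b + 1 by ring, qInt_add, qRatio, qRatio]
  field_simp
  rw [qInt_add_two]
  ring

theorem cupRatio_zero (hN : 2 ≤ N) (a b : ℕ) :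
    cupRatio N a b 0 = N - qRatio N a - qRatio N b := by
  rw [sub_qRatio hN, cupRatio]
  simp [qInt]

/-- This matches the closed form with the recursion of `capMid_projTensor_cupMid_of_capMid`, where
`x` is the previous ratio. -/
theorem cupRatio_succ (hN : 2 ≤ N) (a b r : ℕ) :
    cupRatio N a b (r + 1) = N - qRatio N (a + r + 1) - qRatio N (b + r + 1) +
      qRatio N (a + r + 1) * qRatio N (b + r + 1) * cupRatio N a b r := by
  have h1 := (qInt_pos hN (a + r)).ne'
  have h2 := (qInt_pos hN (b + r)).ne'
  have h3 := (qInt_pos hN (a + r + 1)).ne'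
  have h4 := (qInt_pos hN (b + r + 1)).ne'
  have key := qInt_add N (a + b + r + 2) (r + 1)
  rw [sub_qRatio hN, cupRatio, cupRatio, qRatio, qRatio]
  rw [show a + r + 1 + (b + r + 1) + 2 = r + 1 + (a + b + r + 2) + 1 by ring, key,
    show a + b + (r + 1) + 2 = a + b + r + 2 + 1 by ring, show a + (r + 1) + 1 = a + r + 1 + 1 by ring,
    show b + (r + 1) + 1 = b + r + 1 + 1 by ring]
  field_simp
  ring

theorem cupRatio_nonneg (hN : 2 ≤ N) (a b r : ℕ) : 0 ≤ cupRatio N a b r :=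
  div_nonneg (mul_nonneg (qInt_nonneg hN _) (qInt_nonneg hN _))
    (mul_nonneg (qInt_nonneg hN _) (qInt_nonneg hN _))

/-- The product term in the recursion is nonnegative and can be dropped; the two subtracted ratios
are at most `2/N` each. -/
theorem le_cupRatio (hN : 2 ≤ N) (a b r : ℕ) : N - 4 / N ≤ cupRatio N a b r := by
  have h4 : (4 : ℝ) / N = 2 / N + 2 / N := by ring
  cases r with
  | zero =>
    rw [cupRatio_zero hN]
    linarith [qRatio_le hN a, qRatio_le hN b]
  | succ r =>
    rw [cupRatio_succ hN]
    have := mul_nonneg (mul_nonneg (qRatio_nonneg hN (a + r + 1)) (qRatio_nonneg hN (b + r + 1)))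
      (cupRatio_nonneg hN a b r)
    linarith [qRatio_le hN (a + r + 1), qRatio_le hN (b + r + 1)]

/-- Each `cupRatio` is a quotient of consecutive theta-nets, so the product telescopes to the
normalization of `alpha`. -/
theorem prod_cupRatio (hN : 2 ≤ N) (a b r : ℕ) :
    ∏ i ∈ Finset.range r, cupRatio N a b i =
      thetaNet N (a + b) (a + r) (r + b) r / qSucc N (a + b) := by
  have hpos : ∀ n, qFactorial N n ≠ 0 := fun n =>
    Finset.prod_ne_zero_iff.2 fun i _ => by rw [qSucc_eq_qInt hN]; exact (qInt_pos hN i).ne'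
  have hsucc : ∀ n, qFactorial N (n + 1) = qFactorial N n * qInt N (n + 1) := fun n => by
    rw [qFactorial, Finset.prod_range_succ, qSucc_eq_qInt hN]; rfl
  have h0 := (qInt_pos hN (a + b)).ne'
  induction r with
  | zero =>
    have := hpos a
    have := hpos b
    have := hpos (a + b)
    have h1 : qFactorial N 0 = 1 := rfl
    simp only [Finset.range_zero, Finset.prod_empty, thetaNet, add_zero, zero_add, Nat.sub_zero,
      hsucc, qSucc_eq_qInt hN, h1]
    field_simp
  | succ r ih =>
    rw [Finset.prod_range_succ, ih, thetaNet, thetaNet, cupRatio,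
      show a + r - r = a by omega, show r + b - r = b by omega,
      show a + (r + 1) - (r + 1) = a by omega, show r + 1 + b - (r + 1) = b by omega,
      show r + 1 + b = r + b + 1 by omega, show a + (r + 1) = a + r + 1 by omega,
      show a + b + (r + 1) + 1 = a + b + r + 1 + 1 by omega,
      hsucc r, hsucc (a + r), hsucc (r + b), hsucc (a + b + r + 1), qSucc_eq_qInt hN,
      show b + r + 1 = r + b + 1 by omega]
    have := hpos (a + r)
    have := hpos (r + b)
    have := hpos (a + b)
    have := (qInt_pos hN (a + r)).ne'
    have := (qInt_pos hN (r + b)).ne'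
    field_simp

/-- The projected nested cups over a vector of `H_a ⊗ H_b` killed by the middle contraction. -/
theorem capMid_projTensor_nestCups (hN : 2 ≤ N) {a b : ℕ} {s : TensorPow N a ⊗[ℂ] TensorPow N b}
    (hs : projTensor N a b s = s)
    (h0 : capMid N a b (projTensor N _ _ (cupMid N a b s)) =
      ((N - qRatio N a - qRatio N b : ℝ) : ℂ) • s) (r : ℕ) :
    capMid N (a + r) (b + r) (projTensor N (a + r + 1) (b + r + 1) (nestCups N a b (r + 1) s)) =
      (cupRatio N a b r : ℂ) • projTensor N (a + r) (b + r) (nestCups N a b r s) := by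
  induction r with
  | zero =>
    rw [cupRatio_zero hN]
    exact h0.trans (congrArg _ hs.symm)
  | succ r ih =>
    have h1 := projTensor_cupMid_projTensor (n := a + r + 1) (n' := b + r + 1)
      (nestCups N a b (r + 1) s)
    have h2 := projTensor_cupMid_projTensor (n := a + r) (n' := b + r) (nestCups N a b r s)
    have h3 := capMid_projTensor_cupMid_of_capMid hN (n := a + r) (n' := b + r)
      (projTensor_projTensor (nestCups N a b (r + 1) s)) h2 ih
    rw [cupRatio_succ hN]
    exact (congrArg (capMid N (a + r + 1) (b + r + 1)) h1.symm).trans h3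

/-- The innermost cup on the left becomes a contraction on the right by adjunction, and each
contraction yields one `cupRatio`. -/
theorem inner_projTensor_nestCups (hN : 2 ≤ N) {a b : ℕ} {s : TensorPow N a ⊗[ℂ] TensorPow N b}
    (hs : projTensor N a b s = s)
    (h0 : capMid N a b (projTensor N _ _ (cupMid N a b s)) =
      ((N - qRatio N a - qRatio N b : ℝ) : ℂ) • s) (t : TensorPow N a ⊗[ℂ] TensorPow N b) (r : ℕ) :
    inner ℂ (nestCups N a b r t) (projTensor N _ _ (nestCups N a b r s)) =
      ((∏ i ∈ Finset.range r, cupRatio N a b i : ℝ) : ℂ) * inner ℂ t s := by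
  induction r with
  | zero => simp [nestCups, hs]
  | succ r ih =>
    have h1 := inner_cupMid (nestCups N a b r t) (projTensor N _ _ (nestCups N a b (r + 1) s))
    have h2 := inner_smul_right (𝕜 := ℂ) (nestCups N a b r t)
      (projTensor N (a + r) (b + r) (nestCups N a b r s)) (cupRatio N a b r : ℂ)
    rw [capMid_projTensor_nestCups hN hs h0] at h1
    refine h1.trans (h2.trans ?_)
    rw [ih, Finset.prod_range_succ]
    push_cast
    ring

end Cups

/-! ### The cup insertion as nested cups, and its action on `H_k`. -/

section CupInsert

variable {N : ℕ}

theorem sum_words_snoc {M : Type*} [AddCommMonoid M] {n : ℕ} (g : (Fin (n + 1) → Fin N) → M) :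
    ∑ x, g x = ∑ c, ∑ x : Fin n → Fin N, g (Fin.snoc x c) := by
  rw [← (Fin.snocEquiv fun _ => Fin N).sum_comp, Fintype.sum_prod_type]
  rfl

theorem snoc_comp_rev {n : ℕ} (c : Fin N) (x : Fin n → Fin N) :
    (Fin.snoc x c : Fin (n + 1) → Fin N) ∘ Fin.rev = (Fin.cons c (x ∘ Fin.rev) : _ → _) := by
  ext i
  refine Fin.cases ?_ (fun j => ?_) i
  · simp
  · simp [Fin.rev_succ]

/-- A new innermost cup puts its letter at the end of the left word and at the front of the right
word, hence the reversal. -/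
theorem nestCups_tmul {a b : ℕ} (r : ℕ) (f : TensorPow N a) (g : TensorPow N b) :
    nestCups N a b r (f ⊗ₜ g) = ∑ i : Fin r → Fin N,
      concat N rfl (f ⊗ₜ ket i) ⊗ₜ concat N (Nat.add_comm r b) (ket (i ∘ Fin.rev) ⊗ₜ g) := by
  induction r with
  | zero =>
    rw [Fintype.sum_unique, concat_zero_right]
    have := concat_zero_left (Nat.add_comm 0 b) ((default : Fin 0 → Fin N) ∘ Fin.rev) g
    exact congrArg (fun z => f ⊗ₜ[ℂ] z) this.symm
  | succ r ih =>
    have h1 : nestCups N a b (r + 1) (f ⊗ₜ g) = cupMid N _ _ (nestCups N a b r (f ⊗ₜ g)) := rfl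
    rw [h1, ih, map_sum, sum_words_snoc, Finset.sum_comm]
    refine Finset.sum_congr rfl fun i _ => ?_
    rw [cupMid_tmul]
    refine Finset.sum_congr rfl fun c _ => ?_
    rw [snoc_comp_rev, ← createLast_ket, ← create_ket]
    congr 1
    · exact (concat_createLast (a := a) (b := r) (n := a + r) rfl rfl c f (ket i)).symm
    · exact (concat_create (Nat.add_comm (r + 1) b) (Nat.add_comm r b) c _ g).symm

theorem cupInsert_concat {l m k : ℕ} (a r b : ℕ) (hl : a + r = l) (hm : r + b = m)
    (hk : a + b = k) (f : TensorPow N a) (g : TensorPow N b) :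
    cupInsert N a r b hl hm hk (concat N hk (f ⊗ₜ g)) = ∑ i : Fin r → Fin N,
      concat N hl (f ⊗ₜ ket i) ⊗ₜ concat N hm (ket (i ∘ Fin.rev) ⊗ₜ g) := by
  simp [cupInsert]

theorem cupInsert_eq_nestCups {k : ℕ} (a r b : ℕ) (hk : a + b = k) (ξ : TensorPow N k) :
    cupInsert N a r b rfl (Nat.add_comm r b) hk ξ = nestCups N a b r ((concat N hk).symm ξ) := by
  have : cupInsert N a r b rfl (Nat.add_comm r b) hk ∘ₗ (concat N hk).toLinearEquiv.toLinearMap =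
      nestCups N a b r :=
    TensorProduct.ext' fun f g =>
      (cupInsert_concat a r b rfl _ hk f g).trans (nestCups_tmul r f g).symm
  have h := LinearMap.congr_fun this ((concat N hk).symm ξ)
  simpa using h

theorem inner_concat_symm {a b n : ℕ} (h : a + b = n) (t : TensorPow N a ⊗[ℂ] TensorPow N b)
    (ξ : TensorPow N n) : inner ℂ t ((concat N h).symm ξ) = inner ℂ (concat N h t) ξ := by
  rw [← (concat N h).inner_map_map, LinearIsometryEquiv.apply_symm_apply]

theorem ext_inner_tmul {a b : ℕ} {s t : TensorPow N a ⊗[ℂ] TensorPow N b}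
    (h : ∀ f g, inner ℂ (f ⊗ₜ[ℂ] g) s = inner ℂ (f ⊗ₜ[ℂ] g) t) : s = t := by
  refine ext_inner_left ℂ fun u => ?_
  induction u with
  | zero => simp
  | add u v hu hv => rw [inner_add_left, inner_add_left, hu, hv]
  | tmul f g => exact h f g

theorem projTensor_concat_symm {a b n : ℕ} (h : a + b = n) {ξ : TensorPow N n}
    (hξ : ξ ∈ irrepSpace N n) :
    projTensor N a b ((concat N h).symm ξ) = (concat N h).symm ξ := by
  refine ext_inner_tmul fun f g => ?_
  rw [← inner_projTensor, projTensor_tmul, inner_concat_symm, inner_concat_symm,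
    inner_concat_proj_right h _ _ _ hξ, inner_concat_proj_left h _ _ _ hξ]

theorem capMid_concat_symm {a b n : ℕ} (h : a + 1 + (b + 1) = n) {ξ : TensorPow N n}
    (hξ : ξ ∈ irrepSpace N n) : capMid N a b ((concat N h).symm ξ) = 0 := by
  refine ext_inner_tmul fun f g => ?_
  rw [← inner_cupMid, cupMid_tmul, inner_concat_symm, map_sum, sum_inner,
    sum_inner_concat_cup h f g ξ hξ, inner_zero_right]

/-- The base of the recursion: on `H_k` the contraction across the junction vanishes, which removes
the quadratic term. -/
theorem capMid_projTensor_cupMid_concat_symm (hN : 2 ≤ N) : ∀ {a b n : ℕ} (h : a + b = n)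
    {ξ : TensorPow N n}, ξ ∈ irrepSpace N n →
      capMid N a b (projTensor N _ _ (cupMid N a b ((concat N h).symm ξ))) =
        ((N - qRatio N a - qRatio N b : ℝ) : ℂ) • (concat N h).symm ξ
  | 0, _, _, h, _, hξ =>
    capMid_projTensor_cupMid_of_zero hN (.inl rfl) (projTensor_concat_symm h hξ)
  | _ + 1, 0, _, h, _, hξ =>
    capMid_projTensor_cupMid_of_zero hN (.inr rfl) (projTensor_concat_symm h hξ)
  | _ + 1, _ + 1, _, h, _, hξ => by
    rw [capMid_projTensor_cupMid hN (projTensor_concat_symm h hξ), capMid_concat_symm h hξ]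
    simp

theorem inner_cupInsert {l m k : ℕ} (a r b : ℕ) (hl : a + r = l) (hm : r + b = m)
    (hk : a + b = k) (ζ ξ : TensorPow N k) :
    inner ℂ (cupInsert N a r b hl hm hk ζ) (cupInsert N a r b hl hm hk ξ) =
      ((N ^ r : ℝ) : ℂ) * inner ℂ ζ ξ := by
  subst hl
  obtain rfl : m = b + r := by omega
  rw [cupInsert_eq_nestCups, cupInsert_eq_nestCups, inner_nestCups,
    (concat N hk).symm.inner_map_map]
  push_cast
  rfl

theorem inner_cupInsert_proj (hN : 2 ≤ N) {l m k : ℕ} (a r b : ℕ) (hl : a + r = l)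
    (hm : r + b = m) (hk : a + b = k) (ζ : TensorPow N k) {ξ : TensorPow N k}
    (hξ : ξ ∈ irrepSpace N k) :
    inner ℂ (cupInsert N a r b hl hm hk ζ)
        (projTensor N l m (cupInsert N a r b hl hm hk ξ)) =
      ((∏ i ∈ Finset.range r, cupRatio N a b i : ℝ) : ℂ) * inner ℂ ζ ξ := by
  subst hl
  obtain rfl : m = b + r := by omega
  rw [cupInsert_eq_nestCups, cupInsert_eq_nestCups, inner_projTensor_nestCups hN
    (projTensor_concat_symm hk hξ) (capMid_projTensor_cupMid_concat_symm hN hk hξ),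
    (concat N hk).symm.inner_map_map]

end CupInsert

/-! ### Normalization to isometries, and the partial trace of inserted cups. -/

section Dilations

variable {A B : Type*} [NormedAddCommGroup A] [InnerProductSpace ℂ A]
  [NormedAddCommGroup B] [InnerProductSpace ℂ B]

theorem ketBra_real_smul [FiniteDimensional ℂ A] [FiniteDimensional ℂ B] (c : ℝ) (x : A) (y : B) :
    ketBra ((c : ℂ) • x) ((c : ℂ) • y) = ((c * c : ℝ) : ℂ) • ketBra x y := by
  ext z
  simp only [ketBra_apply, LinearMap.smul_apply, inner_smul_left, Complex.conj_ofReal, smul_smul]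
  congr 1
  push_cast
  ring

/-- Normalization of a pair of maps to isometries. -/
theorem IsometryPair.of_innerScale {V W : A →ₗ[ℂ] B} {p t : ℝ} (hp : 0 < p) (ht : 0 < t)
    (hV : InnerScale V V p) (hW : InnerScale W W t) (h : InnerScale V W p) :
    IsometryPair (((√p⁻¹ : ℝ) : ℂ) • V) (((√t⁻¹ : ℝ) : ℂ) • W) (√(p / t)) := by
  have key : ∀ (u v w : ℝ) {S T : A →ₗ[ℂ] B}, InnerScale S T w →
      InnerScale ((u : ℂ) • S) ((v : ℂ) • T) ((u * v * w : ℝ) : ℂ) := by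
    intro u v w S T hST x y
    rw [LinearMap.smul_apply, LinearMap.smul_apply, inner_smul_left, inner_smul_right, hST,
      Complex.conj_ofReal]
    push_cast
    ring
  have hself : ∀ z : ℝ, 0 < z → √z⁻¹ * √z⁻¹ * z = 1 := fun z hz => by
    rw [Real.mul_self_sqrt (by positivity), inv_mul_cancel₀ hz.ne']
  refine ⟨?_, ?_, ?_⟩
  · have h1 := key (√p⁻¹) (√p⁻¹) p hV
    rwa [hself p hp, Complex.ofReal_one] at h1
  · have h1 := key (√t⁻¹) (√t⁻¹) t hW
    rwa [hself t ht, Complex.ofReal_one] at h1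
  -- The unnormalized overlap is `p` as well, since `V` will be a projection applied to `W`;
  -- normalization gives `p / √(p t)`.
  · have h1 : √p⁻¹ * √t⁻¹ * p = √(p / t) := by
      rw [Real.sqrt_div hp.le, Real.sqrt_inv, Real.sqrt_inv]
      have := Real.mul_self_sqrt hp.le
      field_simp
      nlinarith
    rw [← h1]
    exact key _ _ _ h

theorem id_eq_sum_ketBra {N n : ℕ} :
    (LinearMap.id : TensorPow N n →ₗ[ℂ] TensorPow N n) = ∑ i, ketBra (ket i) (ket i) := by
  simpa [ket] using sum_ketBra (EuclideanSpace.basisFun (Fin n → Fin N) ℂ) LinearMap.id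

theorem inner_concat_ket {N r b m : ℕ} (hm : r + b = m) (i j : Fin r → Fin N)
    (g g' : TensorPow N b) :
    inner ℂ (concat N hm (ket (i ∘ Fin.rev) ⊗ₜ g)) (concat N hm (ket (j ∘ Fin.rev) ⊗ₜ g')) =
      if i = j then inner ℂ g g' else 0 := by
  have h : i ∘ Fin.rev = j ∘ Fin.rev ↔ i = j := Fin.rev_surjective.injective_comp_right.eq_iff
  rw [LinearIsometryEquiv.inner_map_map, TensorProduct.inner_tmul, inner_ket, ket_apply]
  simp [h]

/-- The partial trace of the inserted cups. -/
theorem partialTrace_cupInsert {N l m k : ℕ} (a r b : ℕ) (hl : a + r = l) (hm : r + b = m)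
    (hk : a + b = k) (s t : TensorPow N a ⊗[ℂ] TensorPow N b) :
    partialTrace _ _ (ketBra (cupInsert N a r b hl hm hk (concat N hk s))
      (cupInsert N a r b hl hm hk (concat N hk t))) =
    conj (concat N hl).toLinearEquiv.toLinearMap
      (TensorProduct.map (partialTrace _ _ (ketBra s t)) LinearMap.id) := by
  induction s with
  | zero => simp
  | add s s' hs hs' =>
    simp only [map_add, ketBra_add_left, hs, hs', TensorProduct.map_add_left]
  | tmul f g =>
  induction t with
  | zero => simp
  | add t t' ht ht' =>
    simp only [map_add, ketBra_add_right, ht, ht', TensorProduct.map_add_left]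
  | tmul f' g' =>
    have h1 (i : Fin r → Fin N) :
        conj (concat N hl).toLinearEquiv.toLinearMap
          (TensorProduct.map (ketBra f f') (ketBra (ket i) (ket i))) =
        ketBra (concat N hl (f ⊗ₜ ket i)) (concat N hl (f' ⊗ₜ ket i)) := by
      rw [← ketBra_tmul, conj_apply, comp_ketBra_comp_adjoint]
      rfl
    rw [cupInsert_concat, cupInsert_concat, ketBra_tmul, partialTrace_map, trace_ketBra,
      TensorProduct.map_smul_left, map_smul, id_eq_sum_ketBra]
    have h2 : TensorProduct.map (ketBra f f') (∑ i, ketBra (ket i) (ket i)) =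
        ∑ i : Fin r → Fin N, TensorProduct.map (ketBra f f') (ketBra (ket i) (ket i)) :=
      map_sum (TensorProduct.mapBilinear _ _ _ _ _ (ketBra f f')) _ _
    simp only [h2, map_sum, h1, ketBra_sum_left, ketBra_sum_right, ketBra_tmul, partialTrace_map,
      trace_ketBra, inner_concat_ket, ite_smul, zero_smul, Finset.smul_sum]
    simp

end Dilations

/-! ### The two isometries of the channels and the asymptotics of their overlap. -/

section Channel

variable {N l m k : ℕ}

/-- The normalization `N^{-r/2} (id ⊗ T_{2r} ⊗ id)` of the inserted cups to an isometry. -/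
def cupIsometry (N : ℕ) {l m k : ℕ} (h : Admissible l m k) :
    irrepSpace N k →ₗ[ℂ] TensorPow N l ⊗[ℂ] TensorPow N m :=
  ((√((N : ℝ) ^ cups l m k)⁻¹ : ℝ) : ℂ) •
    (cupInsert N (l - cups l m k) (cups l m k) (m - cups l m k) h.left h.right h.total ∘ₗ
      (irrepSpace N k).subtype)

theorem dilates_alpha (h : Admissible l m k) : Dilates (alpha N h) (Phi N h) :=
  dilates_of_apply fun _ => rfl

/-- Tracing out the second factor forces equal cup letters on both sides, so the `r` letters left in
`H_1^{⊗ l}` carry the identity, with weight `N^{-r}`. -/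
theorem dilates_cupIsometry (h : Admissible l m k) :
    Dilates (cupIsometry N h) (Psi N h) := by
  intro x y
  have h1 := partialTrace_cupInsert (N := N) (l - cups l m k) (cups l m k) (m - cups l m k)
    h.left h.right h.total ((concat N h.total).symm x) ((concat N h.total).symm y)
  rw [LinearIsometryEquiv.apply_symm_apply, LinearIsometryEquiv.apply_symm_apply] at h1
  rw [cupIsometry, LinearMap.smul_apply, LinearMap.smul_apply, ketBra_real_smul, map_smul,
    Real.mul_self_sqrt (by positivity)]
  rw [LinearMap.comp_apply, LinearMap.comp_apply, Submodule.subtype_apply, Submodule.subtype_apply,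
    h1]
  rw [Psi, LinearMap.comp_apply, LinearMap.comp_apply, LinearMap.comp_apply, LinearMap.comp_apply,
    ← map_smul]
  have h2 : conj ((concat N h.total).symm.toLinearEquiv.toLinearMap ∘ₗ (irrepSpace N k).subtype)
      (ketBra x y) = ketBra ((concat N h.total).symm x) ((concat N h.total).symm y) :=
    comp_ketBra_comp_adjoint _ x y
  rw [h2]
  refine congrArg _ ?_
  rw [← TensorProduct.map_smul_right, LinearEquiv.coe_coe, homTensorHomEquiv_apply]
  push_cast
  rfl

/-- Up to scalars `alpha` is `P T` and `cupIsometry` is `T`, with `P` a projection, so the norm and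
the overlap both reduce to `T* P T`. -/
theorem isometryPair_alpha (hN : 2 ≤ N) (h : Admissible l m k) :
    IsometryPair (A := irrepSpace N k) (B := TensorPow N l ⊗[ℂ] TensorPow N m) (alpha N h) (cupIsometry N h)
      √((∏ i ∈ Finset.range (cups l m k),
        cupRatio N (l - cups l m k) (m - cups l m k) i) / N ^ cups l m k) := by
  have hprod := prod_cupRatio hN (l - cups l m k) (m - cups l m k) (cups l m k)
  rw [h.left, h.right, h.total] at hprod
  have hp : 0 < ∏ i ∈ Finset.range (cups l m k),
      cupRatio N (l - cups l m k) (m - cups l m k) i :=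
    Finset.prod_pos fun i _ => div_pos (mul_pos (qInt_pos hN _) (qInt_pos hN _))
      (mul_pos (qInt_pos hN _) (qInt_pos hN _))
  have ht : (0 : ℝ) < (N : ℝ) ^ cups l m k := by positivity
  have ha : alpha N h = ((√(∏ i ∈ Finset.range (cups l m k),
      cupRatio N (l - cups l m k) (m - cups l m k) i)⁻¹ : ℝ) : ℂ) • (projTensor N l m ∘ₗ
        cupInsert N (l - cups l m k) (cups l m k) (m - cups l m k) h.left h.right h.total ∘ₗ
      (irrepSpace N k).subtype) := by
    rw [hprod, inv_div]
    rfl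
  rw [ha, cupIsometry]
  refine IsometryPair.of_innerScale hp ht (fun x y => ?_) (fun x y => ?_) (fun x y => ?_)
  · simp only [LinearMap.comp_apply]
    rw [inner_projTensor, projTensor_projTensor]
    exact inner_cupInsert_proj hN _ _ _ h.left h.right h.total _ y.2
  · exact inner_cupInsert _ _ _ h.left h.right h.total _ _
  · simp only [LinearMap.comp_apply]
    rw [inner_projTensor]
    exact inner_cupInsert_proj hN _ _ _ h.left h.right h.total _ y.2

/-- Bernoulli's inequality: each factor divided by `N` is at least `1 - 4/N²`, which is nonnegative
for `N ≥ 2`. -/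
theorem one_sub_le_prod_cupRatio (hN : 2 ≤ N) (a b r : ℕ) :
    1 - 4 * r / N ^ 2 ≤ (∏ i ∈ Finset.range r, cupRatio N a b i) / (N : ℝ) ^ r := by
  have h2 : (2 : ℝ) ≤ N := by exact_mod_cast hN
  have h0 : (0 : ℝ) < N := by linarith
  have h4 : (4 : ℝ) / N ^ 2 ≤ 1 := by
    rw [div_le_one (by positivity)]
    nlinarith
  have hb := one_add_mul_le_pow (a := -(4 / (N : ℝ) ^ 2)) (by linarith) r
  have hle : (1 + -(4 / (N : ℝ) ^ 2)) ^ r ≤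
      (∏ i ∈ Finset.range r, cupRatio N a b i) / (N : ℝ) ^ r := by
    have : (∏ i ∈ Finset.range r, cupRatio N a b i) / (N : ℝ) ^ r =
        ∏ i ∈ Finset.range r, (cupRatio N a b i / N) := by
      rw [Finset.prod_div_distrib, Finset.prod_const, Finset.card_range]
    rw [this]
    refine (Finset.prod_le_prod (f := fun _ => 1 + -(4 / (N : ℝ) ^ 2)) (fun i _ => by linarith)
      fun i _ => ?_).trans_eq' (by simp)
    rw [le_div_iff₀ h0]
    refine le_trans (le_of_eq ?_) (le_cupRatio hN a b i)
    field_simp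
    ring
  refine le_trans (le_of_eq ?_) (hb.trans hle)
  ring

/-- The lower bound passes from `x` to `√x`: for `x` in `[0, 1]` because `√x ≥ x`, and outside this
interval directly. -/
theorem sqrt_defect_le (hN : 2 ≤ N) {x : ℝ} {r : ℕ} (h : 1 - 4 * r / N ^ 2 ≤ x) :
    √(2 * (1 - √x)) ≤ √(8 * r) / N := by
  have hN0 : (0 : ℝ) < N := by exact_mod_cast (by omega : 0 < N)
  have h0 : (0 : ℝ) ≤ 4 * r / N ^ 2 := by positivity
  have h1 : 1 - 4 * r / N ^ 2 ≤ √x := by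
    rcases le_total x 1 with hx | hx
    · rcases le_total x 0 with hx0 | hx0
      · exact (h.trans hx0).trans (Real.sqrt_nonneg _)
      · exact h.trans (Real.le_sqrt_of_sq_le (by nlinarith))
    · linarith [Real.one_le_sqrt.2 hx]
  rw [show √(8 * r) / N = √(8 * r / (N : ℝ) ^ 2) by
    rw [Real.sqrt_div (by positivity), Real.sqrt_sq hN0.le]]
  refine Real.sqrt_le_sqrt ?_
  rw [show (8 * r : ℝ) / N ^ 2 = 2 * (4 * r / N ^ 2) by ring]
  linarith

end Channel

end TLChannel

end

/-! ### The asymptotic estimate, with constants `√(8r)` and `2√(8r)` valid for all `N ≥ 2`. -/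

open TLChannel in
theorem corollary2 (l m k : ℕ) (h : Admissible l m k)
    {A' B' : Type*}
    [NormedAddCommGroup A'] [InnerProductSpace ℂ A'] [FiniteDimensional ℂ A']
    [NormedAddCommGroup B'] [InnerProductSpace ℂ B'] [FiniteDimensional ℂ B']
    (Φ' : (A' →ₗ[ℂ] A') →ₗ[ℂ] (B' →ₗ[ℂ] B')) (hΦ' : IsQuantumChannel Φ') :
    (∃ C : ℝ, ∀ᶠ N : ℕ in atTop,
      buresDist (tensorMap (Phi N h) Φ') (tensorMap (Psi N h) Φ') ≤ ENNReal.ofReal (C / N)) ∧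
    (∃ C : ℝ, ∀ᶠ N : ℕ in atTop,
      diamondNorm (tensorMap (Phi N h) Φ' - tensorMap (Psi N h) Φ') ≤
        ENNReal.ofReal (C / N)) := by
  have key : ∀ N : ℕ, 2 ≤ N → _ := fun N hN =>
    dist_tensorMap_le (dilates_alpha h) (dilates_cupIsometry h) (isometryPair_alpha hN h) hΦ'
  have hb : ∀ N : ℕ, 2 ≤ N → _ := fun N hN => sqrt_defect_le hN
    (one_sub_le_prod_cupRatio hN (l - cups l m k) (m - cups l m k) (cups l m k))
  refine ⟨⟨√(8 * cups l m k), ?_⟩, ⟨2 * √(8 * cups l m k), ?_⟩⟩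
  · filter_upwards [eventually_ge_atTop 2] with N hN
    exact (key N hN).1.trans (ENNReal.ofReal_le_ofReal (hb N hN))
  · filter_upwards [eventually_ge_atTop 2] with N hN
    refine (key N hN).2.trans (ENNReal.ofReal_le_ofReal ?_)
    rw [mul_div_assoc]
    exact mul_le_mul_of_nonneg_left (hb N hN) zero_le_two
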